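/- A finite set of points in the plane is in general position if no three of its points are collinear. Let $S$ be such a set, each of whose points is assigned one of $k$ colors. A triangle with vertices in $S$ is empty if its interior contains no point of $S$, and rainbow if its three vertices have pairwise different colors. For $k \ge 3$ and $m \ge 0$, let $f(k,m)$ be the minimum number of empty rainbow triangles determined by $S$, over all $k$-colored point sets $S$ in general position in the plane with exactly $m$ points of each of the $k$ colors. **Theorem.** $f(k,m) = \Theta(k^2 m)$ if $m < k$, and $f(k,m) = \Theta(k^3)$ if $m \ge k$. That is, there are absolute constants $c, C > 0$ such that for all integers $k \ge 3$ and $m \ge 0$: if $m < k$ then $c\,k^2 m \le f(k,m) \le C\,k^2 m$, and if $m \ge k$ then $c\,k^3 \le f(k,m) \le C\,k^3$. -/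

import Mathlib

/-- The Euclidean plane. -/
abbrev Plane : Type := EuclideanSpace ℝ (Fin 2)

/-- A set of points is in general position if no three of its points are collinear. -/
def InGeneralPosition (S : Set Plane) : Prop :=
  ∀ p ∈ S, ∀ q ∈ S, ∀ r ∈ S, p ≠ q → p ≠ r → q ≠ r → ¬ Collinear ℝ {p, q, r}

/-- A `k`-colored finite point set in general position in the plane, with exactly `m` points of
each of the `k` colors. (Only the values of `color` on `points` matter.) -/
structure ColoredPointSet (k m : ℕ) where
  points : Finset Plane
  color : Plane → Fin k
  generalPosition : InGeneralPosition (points : Set Plane)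
  card_colorClass : ∀ c : Fin k, (points.filter (fun p => color p = c)).card = m

namespace ColoredPointSet

variable {k m : ℕ}

/-- A triangle determined by `S`, given as the set `T` of its three vertices. -/
def IsTriangle (S : ColoredPointSet k m) (T : Finset Plane) : Prop :=
  T ⊆ S.points ∧ T.card = 3

/-- The triangle with vertex set `T` is empty: no point of `S` lies in its interior. -/
def IsEmptyTriangle (S : ColoredPointSet k m) (T : Finset Plane) : Prop :=
  ∀ p ∈ S.points, p ∉ interior (convexHull ℝ (T : Set Plane))

/-- All vertices have different colors. -/
def IsRainbow (S : ColoredPointSet k m) (T : Finset Plane) : Prop :=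
  Set.InjOn S.color (T : Set Plane)

/-- The number of empty rainbow triangles determined by `S`. -/
noncomputable def numEmptyRainbowTriangles (S : ColoredPointSet k m) : ℕ :=
  Set.ncard {T : Finset Plane | S.IsTriangle T ∧ S.IsEmptyTriangle T ∧ S.IsRainbow T}

end ColoredPointSet

/-- The minimum number of empty rainbow triangles over all `k`-colored point sets in general
position in the plane with exactly `m` points of each color. -/
noncomputable def minEmptyRainbowTriangles (k m : ℕ) : ℕ :=
  sInf (Set.range (fun S : ColoredPointSet k m => S.numEmptyRainbowTriangles))

/-! Both regimes are the single estimate `f(k,m) = Θ(k² · min m k)`.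

Lower bound. Fix a linear functional `φ` injective on `S`. Around each `p`, sort radially the points
preceding `p`. Two radially consecutive ones form with `p` an empty triangle, whose `φ`-largest
vertex is `p`, so no triangle is counted twice. If `D` colors other than that of `p` occur before
`p`, and `s` points of the color of `p` do, at least `D - 1 - s` of these triangles are rainbow
(`card_erase_image_le`). Choosing about `k` colors, and in each about `min m k` points for which `D`
is of order `k` and `s` is a smaller fraction of `k`, gives the bound
(`le_numEmptyRainbowTriangles`).

Upper bound. Take a Horton set of `k` points and replace each point by a monochromatic cluster of
`m` points. A rainbow triangle then has its vertices in three clusters, and if it is empty, so is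
the underlying Horton triangle. Such a triangle has two vertices `p`, `q` differing by a power `2 ^
v` and satisfying a rigid congruence (`IsHortonParam.dyadic_of_empty`). Inside a cluster, points
tend to the center along directions aimed, with a slight tilt to either side, at prescribed other
clusters. A triangle with an edge towards the `g`-th target therefore contains a cluster point
unless its vertex has index below `2 * g + 2` (`exists_cluster_blowup`). The targets `c ± 2 ^ v` are
listed early, so the vertices over `p` and `q` have only `O(v)` choices each, and the third has at
most `min m (6 * k)`. The sum over `v` converges because of the factor `2 ^ v` in the denominator
(`ncard_le_of_dyadic_parametrization`). -/

/-! ### Orientations and interiors of triangles. -/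

/-- Twice the signed area of the triangle `p q r`. -/
def orient (p q r : Plane) : ℝ :=
  (q 0 - p 0) * (r 1 - p 1) - (q 1 - p 1) * (r 0 - p 0)

theorem orient_rotate (p q r : Plane) : orient q r p = orient p q r := by
  unfold orient; ring

theorem orient_swap (p q r : Plane) : orient p r q = -orient p q r := by
  unfold orient; ring

theorem continuous_orient (p q : Plane) : Continuous (orient p q) := by
  unfold orient; fun_prop

theorem orient_eq_zero_of_collinear {p q r : Plane} (h : Collinear ℝ {p, q, r}) :
    orient p q r = 0 := by
  rw [collinear_iff_of_mem (p₀ := p) (by simp)] at h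
  obtain ⟨v, hv⟩ := h
  obtain ⟨s, rfl⟩ := hv q (by simp)
  obtain ⟨t, rfl⟩ := hv r (by simp)
  simp only [orient, vadd_eq_add, PiLp.add_apply, PiLp.smul_apply, smul_eq_mul]
  ring

theorem collinear_of_orient_eq_zero {p q r : Plane} (hpq : p ≠ q) (h : orient p q r = 0) :
    Collinear ℝ {p, q, r} := by
  rw [collinear_iff_of_mem (p₀ := p) (by simp)]
  have key : ∃ t : ℝ, r = t • (q - p) +ᵥ p := by
    unfold orient at h
    by_cases h0 : q 0 = p 0
    · have h1 : q 1 - p 1 ≠ 0 := by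
        intro h1
        apply hpq
        ext i
        fin_cases i
        · exact h0.symm
        · exact (sub_eq_zero.1 h1).symm
      refine ⟨(r 1 - p 1) / (q 1 - p 1), ?_⟩
      have h2 : r 0 - p 0 = 0 := by
        rw [h0] at h
        have : (q 1 - p 1) * (r 0 - p 0) = 0 := by linarith
        exact (mul_eq_zero.1 this).resolve_left h1
      ext i
      fin_cases i
      · simp [h0]; linarith
      · simp; field_simp; ring
    · have h1 : q 0 - p 0 ≠ 0 := sub_ne_zero.2 h0
      refine ⟨(r 0 - p 0) / (q 0 - p 0), ?_⟩
      ext i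
      fin_cases i
      · simp; field_simp; ring
      · simp; field_simp; linarith
  obtain ⟨t, ht⟩ := key
  refine ⟨q - p, ?_⟩
  intro x hx
  simp only [Set.mem_insert_iff, Set.mem_singleton_iff] at hx
  rcases hx with rfl | rfl | rfl
  · exact ⟨0, by simp⟩
  · exact ⟨1, by simp⟩
  · exact ⟨t, ht⟩

/-- The three orientations divided by their sum are barycentric coordinates, and the three strict
inequalities cut out an open set. -/
theorem mem_interior_triangle {a b c x : Plane} (h₁ : 0 < orient a b x) (h₂ : 0 < orient b c x)
    (h₃ : 0 < orient c a x) : x ∈ interior (convexHull ℝ ({a, b, c} : Set Plane)) := by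
  rw [mem_interior]
  refine ⟨{y | 0 < orient a b y ∧ 0 < orient b c y ∧ 0 < orient c a y}, ?_, ?_, h₁, h₂, h₃⟩
  · rintro y ⟨g₁, g₂, g₃⟩
    have hD : 0 < orient a b y + orient b c y + orient c a y := by positivity
    set D := orient a b y + orient b c y + orient c a y with hDdef
    have := (convex_convexHull ℝ ({a, b, c} : Set Plane)).sum_mem (t := Finset.univ)
      (w := ![orient b c y / D, orient c a y / D, orient a b y / D]) (z := ![a, b, c])
      (by intro i _; fin_cases i <;> simp <;> positivity)
      (by simp [Fin.sum_univ_three]; field_simp; rw [hDdef]; ring)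
      (by intro i _; apply subset_convexHull; fin_cases i <;> simp)
    convert this using 1
    simp only [Fin.sum_univ_three, Matrix.cons_val]
    ext i
    fin_cases i <;>
    · simp
      field_simp
      rw [hDdef]
      unfold orient
      ring
  · exact (isOpen_lt continuous_const (continuous_orient a b)).inter
      ((isOpen_lt continuous_const (continuous_orient b c)).inter
        (isOpen_lt continuous_const (continuous_orient c a)))

theorem mem_interior_triangle_of_mul_pos {a b c x : Plane} (s : ℝ) (h₁ : 0 < s * orient a b x)
    (h₂ : 0 < s * orient b c x) (h₃ : 0 < s * orient c a x) :
    x ∈ interior (convexHull ℝ ({a, b, c} : Set Plane)) := by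
  rcases lt_trichotomy s 0 with hs | hs | hs
  · have := mem_interior_triangle (a := b) (b := a) (c := c) (x := x)
      (by have := neg_of_mul_pos_right h₁ hs.le; unfold orient at *; linarith)
      (by have := neg_of_mul_pos_right h₃ hs.le; unfold orient at *; linarith)
      (by have := neg_of_mul_pos_right h₂ hs.le; unfold orient at *; linarith)
    rwa [Set.insert_comm] at this
  · simp [hs] at h₁
  · exact mem_interior_triangle (pos_of_mul_pos_right h₁ hs.le) (pos_of_mul_pos_right h₂ hs.le)
      (pos_of_mul_pos_right h₃ hs.le)

theorem orient_pos_of_mem_interior {a b c x : Plane} (h : 0 < orient a b c)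
    (hx : x ∈ interior (convexHull ℝ ({a, b, c} : Set Plane))) : 0 < orient a b x := by
  have hsub : convexHull ℝ ({a, b, c} : Set Plane) ⊆ {y | 0 ≤ orient a b y} := by
    apply convexHull_min
    · intro y hy
      simp only [Set.mem_insert_iff, Set.mem_singleton_iff] at hy
      rcases hy with rfl | rfl | rfl
      · simp [orient]
      · simp only [orient, Set.mem_ofPred_eq]; apply le_of_eq; ring
      · exact h.le
    · intro y hy z hz s t hs ht hst
      have e : orient a b (s • y + t • z) = s * orient a b y + t * orient a b z := by
        obtain rfl : s = 1 - t := by linarith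
        simp only [orient, PiLp.add_apply, PiLp.smul_apply, smul_eq_mul]
        ring
      simp only [Set.mem_ofPred_eq] at hy hz ⊢
      rw [e]
      positivity
  -- The outward normal of the edge `a b`: an interior point can be pushed a little along it without
  -- leaving the closed half-plane, so its own inequality is strict.
  let n : Plane := !₂[b 1 - a 1, -(b 0 - a 0)]
  have hc : Filter.Tendsto (fun t : ℝ => x + t • n) (nhdsWithin 0 (Set.Ioi 0)) (nhds x) := by
    have : Continuous (fun t : ℝ => x + t • n) := by fun_prop
    have h0 := this.tendsto 0
    simp only [zero_smul, add_zero] at h0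
    exact h0.mono_left nhdsWithin_le_nhds
  have hev := (hc.eventually (mem_interior_iff_mem_nhds.1 hx)).and self_mem_nhdsWithin
  obtain ⟨t, ht, ht0⟩ := hev.exists
  have h1 := hsub ht
  have h2 : orient a b (x + t • n) =
      orient a b x - t * ((b 0 - a 0) ^ 2 + (b 1 - a 1) ^ 2) := by
    simp [orient, n]; ring
  simp only [Set.mem_ofPred_eq, h2] at h1
  have h3 : 0 < (b 0 - a 0) ^ 2 + (b 1 - a 1) ^ 2 := by
    by_contra hle
    have e0 : b 0 - a 0 = 0 := by nlinarith [sq_nonneg (b 0 - a 0), sq_nonneg (b 1 - a 1)]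
    have e1 : b 1 - a 1 = 0 := by nlinarith [sq_nonneg (b 0 - a 0), sq_nonneg (b 1 - a 1)]
    simp [orient, e0, e1] at h
  have : 0 < t * ((b 0 - a 0) ^ 2 + (b 1 - a 1) ^ 2) := mul_pos ht0 h3
  linarith

/-! ### Lower bound: rainbow pairs in radial orders. -/

-- For each color other than `i₀`, look at its first occurrence in the order given by `key`. The
-- immediate predecessor has a different color. Either it does not exist (at most one color), or it
-- has color `i₀` (injectively charged to that point), or the two form a pair of the last set.
open Classical in
theorem card_erase_image_le {α κ : Type*} (A : Finset α) (key : α → ℝ)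
    (hkey : Set.InjOn key A) (col : α → κ) (i₀ : κ) :
    ((A.image col).erase i₀).card ≤ 1 + (A.filter (fun x => col x = i₀)).card +
      ((A ×ˢ A).filter (fun z => key z.1 < key z.2 ∧ col z.1 ≠ i₀ ∧ col z.2 ≠ i₀ ∧
        col z.1 ≠ col z.2 ∧ ∀ x ∈ A, ¬ (key z.1 < key x ∧ key x < key z.2))).card := by
  rcases isEmpty_or_nonempty α with _ | _
  · simp [Finset.eq_empty_of_isEmpty A]
  set Col := (A.image col).erase i₀
  have first : ∀ c ∈ Col,
      ∃ r ∈ A, col r = c ∧ ∀ x ∈ A, col x = c → key r ≤ key x := by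
    intro c hc
    obtain ⟨x, hx, hxc⟩ := Finset.mem_image.1 (Finset.mem_of_mem_erase hc)
    obtain ⟨r, hr, hmin⟩ := Finset.exists_min_image (A.filter (fun x => col x = c)) key
      ⟨x, by simp [hx, hxc]⟩
    simp only [Finset.mem_filter] at hr hmin
    exact ⟨r, hr.1, hr.2, fun x h1 h2 => hmin x ⟨h1, h2⟩⟩
  have pred : ∀ r ∈ A, (∃ x ∈ A, key x < key r) →
      ∃ q ∈ A, key q < key r ∧ ∀ x ∈ A, key x < key r → key x ≤ key q := by
    rintro r - ⟨x, hx, hxr⟩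
    obtain ⟨q, hq, hmax⟩ := Finset.exists_max_image (A.filter (fun x => key x < key r)) key
      ⟨x, by simp [hx, hxr]⟩
    simp only [Finset.mem_filter] at hq hmax
    exact ⟨q, hq.1, hq.2, fun x h1 h2 => hmax x ⟨h1, h2⟩⟩
  choose! r hrA hrc hrmin using first
  choose! q hqA hqlt hqmax using pred
  -- Split the colors by whether the first occurrence has a predecessor, then by whether that
  -- predecessor has color `i₀`.
  rw [← Finset.card_filter_add_card_filter_not (s := Col) (fun c => ∃ x ∈ A, key x < key (r c)),
    ← Finset.card_filter_add_card_filter_not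
      (s := Col.filter (fun c => ∃ x ∈ A, key x < key (r c))) (fun c => col (q (r c)) = i₀)]
  have h1 : (Col.filter (fun c => ¬ ∃ x ∈ A, key x < key (r c))).card ≤ 1 := by
    rw [Finset.card_le_one]
    intro c hc c' hc'
    simp only [Finset.mem_filter, not_exists, not_and, not_lt] at hc hc'
    rw [← hrc c hc.1, ← hrc c' hc'.1]
    congr 1
    exact hkey (hrA c hc.1) (hrA c' hc'.1)
      (le_antisymm (hc.2 _ (hrA c' hc'.1)) (hc'.2 _ (hrA c hc.1)))
  have h2 : ((Col.filter (fun c => ∃ x ∈ A, key x < key (r c))).filter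
      (fun c => col (q (r c)) = i₀)).card ≤ (A.filter (fun x => col x = i₀)).card := by
    apply Finset.card_le_card_of_injOn (fun c => q (r c))
    · intro c hc
      simp only [Finset.coe_filter, Finset.mem_filter, Set.mem_ofPred_eq] at hc ⊢
      exact ⟨hqA _ (hrA c hc.1.1) hc.1.2, hc.2⟩
    · intro c hc c' hc' h
      simp only [Finset.coe_filter, Finset.mem_filter, Set.mem_ofPred_eq] at hc hc' h
      have hle : ∀ d d', d ∈ Col → d' ∈ Col → (∃ x ∈ A, key x < key (r d)) →
          (∃ x ∈ A, key x < key (r d')) → q (r d) = q (r d') → key (r d') ≤ key (r d) := by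
        intro d d' hd hd' he he' hq
        by_contra! hlt
        have := hqmax (r d') (hrA d' hd') he' (r d) (hrA d hd) hlt
        rw [← hq] at this
        exact absurd (hqlt (r d) (hrA d hd) he) this.not_gt
      rw [← hrc c hc.1.1, ← hrc c' hc'.1.1]
      congr 1
      exact hkey (hrA c hc.1.1) (hrA c' hc'.1.1) (le_antisymm
        (hle c' c hc'.1.1 hc.1.1 hc'.1.2 hc.1.2 h.symm) (hle c c' hc.1.1 hc'.1.1 hc.1.2 hc'.1.2 h))
  have h3 : ((Col.filter (fun c => ∃ x ∈ A, key x < key (r c))).filter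
      (fun c => ¬ col (q (r c)) = i₀)).card ≤
      ((A ×ˢ A).filter (fun z => key z.1 < key z.2 ∧ col z.1 ≠ i₀ ∧ col z.2 ≠ i₀ ∧
        col z.1 ≠ col z.2 ∧ ∀ x ∈ A, ¬ (key z.1 < key x ∧ key x < key z.2))).card := by
    apply Finset.card_le_card_of_injOn (fun c => (q (r c), r c))
    · intro c hc
      simp only [Finset.coe_filter, Finset.mem_filter, Finset.mem_product,
        Set.mem_ofPred_eq] at hc ⊢
      obtain ⟨⟨hc, he⟩, hne⟩ := hc
      have hr := hrA c hc
      refine ⟨⟨hqA _ hr he, hr⟩, hqlt _ hr he, hne, ?_, ?_, ?_⟩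
      · rw [hrc c hc]; exact Finset.ne_of_mem_erase hc
      · rw [hrc c hc]
        intro h
        exact absurd (hqlt _ hr he) (hrmin c hc _ (hqA _ hr he) h).not_gt
      · rintro x hx ⟨hx1, hx2⟩
        exact absurd hx1 (hqmax _ hr he x hx hx2).not_gt
    · intro c hc c' hc' h
      simp only [Finset.coe_filter, Finset.mem_filter, Set.mem_ofPred_eq] at hc hc'
      have := (Prod.ext_iff.1 h).2
      simp only at this
      rw [← hrc c hc.1.1, ← hrc c' hc'.1.1, this]
  omega

theorem injOn_rank {α : Type*} {B : Finset α} {f : α → ℝ} (hf : Set.InjOn f B) :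
    Set.InjOn (fun x => (B.filter (fun y => f y < f x)).card) B := by
  have mono : ∀ x ∈ B, ∀ y, f x < f y →
      (B.filter (fun z => f z < f x)).card < (B.filter (fun z => f z < f y)).card := by
    intro x hx y hxy
    apply Finset.card_lt_card
    rw [Finset.ssubset_iff_of_subset]
    · exact ⟨x, by simp [hx, hxy], by simp⟩
    · intro z hz
      simp only [Finset.mem_filter] at hz ⊢
      exact ⟨hz.1, hz.2.trans hxy⟩
  intro x hx y hy h
  apply hf hx hy
  rcases lt_trichotomy (f x) (f y) with hlt | heq | hlt
  · exact absurd h (mono x hx y hlt).ne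
  · exact heq
  · exact absurd h (mono y hy x hlt).ne'

theorem image_rank {α : Type*} {B : Finset α} {f : α → ℝ} (hf : Set.InjOn f B) :
    B.image (fun x => (B.filter (fun y => f y < f x)).card) = Finset.range B.card := by
  apply Finset.eq_of_subset_of_card_le
  · intro j hj
    obtain ⟨x, hx, rfl⟩ := Finset.mem_image.1 hj
    rw [Finset.mem_range]
    apply Finset.card_lt_card
    rw [Finset.ssubset_iff_of_subset (Finset.filter_subset _ _)]
    exact ⟨x, hx, by simp⟩
  · rw [Finset.card_image_of_injOn (injOn_rank hf), Finset.card_range]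

theorem card_filter_rank {α : Type*} {B : Finset α} {f : α → ℝ} (hf : Set.InjOn f B) (a : ℕ)
    {b : ℕ} (hb : b ≤ B.card) :
    (B.filter (fun x => a ≤ (B.filter (fun y => f y < f x)).card ∧
      (B.filter (fun y => f y < f x)).card < b)).card = b - a := by
  rw [← Nat.card_Ico a b, ← Finset.card_image_of_injOn
    ((injOn_rank hf).mono (Finset.coe_subset.2 (Finset.filter_subset _ _)))]
  congr 1
  ext j
  simp only [Finset.mem_image, Finset.mem_filter, Finset.mem_Ico]
  constructor
  · rintro ⟨x, ⟨-, h⟩, rfl⟩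
    exact h
  · intro h
    have : j ∈ B.image (fun x => (B.filter (fun y => f y < f x)).card) := by
      rw [image_rank hf, Finset.mem_range]; omega
    obtain ⟨x, hx, rfl⟩ := Finset.mem_image.1 this
    exact ⟨x, ⟨hx, h⟩, rfl⟩

/-- Each pair of points with different second coordinates excludes only one value of `θ`. -/
theorem exists_injOn_linear (S : Finset Plane) :
    ∃ θ : ℝ, Set.InjOn (fun x : Plane => x 0 + θ * x 1) S := by
  classical
  obtain ⟨θ, hθ⟩ := Infinite.exists_notMem_finset
    ((S ×ˢ S).image (fun z : Plane × Plane => -(z.1 0 - z.2 0) / (z.1 1 - z.2 1)))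
  refine ⟨θ, fun x hx y hy h => ?_⟩
  simp only at h
  by_cases h1 : x 1 = y 1
  · rw [h1] at h
    ext i
    fin_cases i
    · exact add_right_cancel h
    · exact h1
  · exfalso
    apply hθ
    rw [Finset.mem_image]
    refine ⟨(x, y), Finset.mem_product.2 ⟨hx, hy⟩, ?_⟩
    have := sub_ne_zero.2 h1
    simp only
    field_simp
    linarith

namespace ColoredPointSet

variable {k m : ℕ}

theorem finite_emptyRainbowTriangles (S : ColoredPointSet k m) :
    {T : Finset Plane | S.IsTriangle T ∧ S.IsEmptyTriangle T ∧ S.IsRainbow T}.Finite :=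
  (Finset.finite_toSet S.points.powerset).subset fun T hT => by
    simpa using hT.1.1

open Classical in
/-- The points of `S` preceding `p` in the direction determined by `φ`. -/
noncomputable def before (S : ColoredPointSet k m) (φ : Plane → ℝ) (p : Plane) : Finset Plane :=
  S.points.filter (fun x => φ x < φ p)

open Classical in
/-- Pairs of points preceding `p` which are consecutive in the radial order around `p` and which
form a rainbow triangle with `p`. -/
noncomputable def radialPairs (S : ColoredPointSet k m) (φ : Plane → ℝ) (p : Plane) :
    Finset (Plane × Plane) :=
  (S.before φ p ×ˢ S.before φ p).filter (fun z =>
    (z.1 1 - p 1) / (φ z.1 - φ p) < (z.2 1 - p 1) / (φ z.2 - φ p) ∧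
    S.color z.1 ≠ S.color p ∧ S.color z.2 ≠ S.color p ∧ S.color z.1 ≠ S.color z.2 ∧
    ∀ x ∈ S.before φ p, ¬ ((z.1 1 - p 1) / (φ z.1 - φ p) < (x 1 - p 1) / (φ x - φ p) ∧
      (x 1 - p 1) / (φ x - φ p) < (z.2 1 - p 1) / (φ z.2 - φ p)))

/-- Replacing the first coordinate by `φ` is a shear, which preserves orientation; in the open
half-plane before `p`, slope in the sheared coordinates is then monotone in the angle. -/
theorem orient_pos_iff_radial_lt {θ : ℝ} {p q r : Plane}
    (hq : q 0 + θ * q 1 < p 0 + θ * p 1) (hr : r 0 + θ * r 1 < p 0 + θ * p 1) :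
    0 < orient p q r ↔ (q 1 - p 1) / (q 0 + θ * q 1 - (p 0 + θ * p 1)) <
      (r 1 - p 1) / (r 0 + θ * r 1 - (p 0 + θ * p 1)) := by
  rw [← neg_div_neg_eq (q 1 - p 1), ← neg_div_neg_eq (r 1 - p 1),
    div_lt_div_iff₀ (by linarith) (by linarith), orient]
  constructor <;> intro h <;> linarith

theorem orient_ne_zero (S : ColoredPointSet k m) {p q r : Plane} (hp : p ∈ S.points)
    (hq : q ∈ S.points) (hr : r ∈ S.points) (hpq : p ≠ q) (hpr : p ≠ r) (hqr : q ≠ r) :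
    orient p q r ≠ 0 := fun h =>
  S.generalPosition p hp q hq r hr hpq hpr hqr (collinear_of_orient_eq_zero hpq h)

theorem card_colors_before_le (S : ColoredPointSet k m) (θ : ℝ) {p : Plane} (hp : p ∈ S.points) :
    (((S.before (fun x => x 0 + θ * x 1) p).image S.color).erase (S.color p)).card ≤
      1 + ((S.before (fun x => x 0 + θ * x 1) p).filter (fun x => S.color x = S.color p)).card +
      (S.radialPairs (fun x => x 0 + θ * x 1) p).card := by
  have := card_erase_image_le (S.before (fun x => x 0 + θ * x 1) p)
    (fun x => (x 1 - p 1) / (x 0 + θ * x 1 - (p 0 + θ * p 1))) ?_ S.color (S.color p)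
  · unfold radialPairs; convert this
  · intro q hq r hr h
    simp only [before, Finset.coe_filter, Set.mem_ofPred_eq] at hq hr
    by_contra hne
    have hpq : p ≠ q := by rintro rfl; exact lt_irrefl _ hq.2
    have hpr : p ≠ r := by rintro rfl; exact lt_irrefl _ hr.2
    rcases (S.orient_ne_zero hp hq.1 hr.1 hpq hpr hne).lt_or_gt with h1 | h1
    · have : 0 < orient p r q := by rw [orient_swap]; linarith
      rw [orient_pos_iff_radial_lt hr.2 hq.2] at this
      exact this.ne' h
    · rw [orient_pos_iff_radial_lt hq.2 hr.2] at h1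
      exact h1.ne h

open Classical in
theorem sum_card_radialPairs_le (S : ColoredPointSet k m) {θ : ℝ}
    (hθ : Set.InjOn (fun x : Plane => x 0 + θ * x 1) S.points) :
    ∑ p ∈ S.points, (S.radialPairs (fun x => x 0 + θ * x 1) p).card ≤
      S.numEmptyRainbowTriangles := by
  set φ : Plane → ℝ := fun x => x 0 + θ * x 1 with hφ
  rw [← Finset.card_sigma]
  let f : (Σ _ : Plane, Plane × Plane) → Finset Plane := fun z => {z.1, z.2.1, z.2.2}
  -- The vertex set recovers `p` as its `φ`-maximum, and the radial order then distinguishes `q`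
  -- from `r`.
  have hinj : Set.InjOn f (S.points.sigma (fun p => S.radialPairs φ p) : Set _) := by
    rintro ⟨p, q, r⟩ h ⟨p', q', r'⟩ h' heq
    simp only [Finset.coe_sigma, Set.mem_sigma_iff, Finset.mem_coe, radialPairs, before,
      Finset.mem_filter, Finset.mem_product] at h h'
    obtain ⟨-, ⟨⟨-, hq⟩, -, hr⟩, hlt, -⟩ := h
    obtain ⟨-, ⟨⟨-, hq'⟩, -, hr'⟩, hlt', -⟩ := h'
    have hext : ∀ x, (x = p ∨ x = q ∨ x = r) ↔ (x = p' ∨ x = q' ∨ x = r') := by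
      intro x
      have := Finset.ext_iff.1 heq x
      simpa [f] using this
    have hpp : p = p' := by
      rcases (hext p).1 (Or.inl rfl) with h | h | h
      · exact h
      · rcases (hext p').2 (Or.inl rfl) with g | g | g <;> subst h g <;> first | rfl | linarith
      · rcases (hext p').2 (Or.inl rfl) with g | g | g <;> subst h g <;> first | rfl | linarith
    subst hpp
    have hqp : q ≠ p := by rintro rfl; exact lt_irrefl _ hq
    have hrp : r ≠ p := by rintro rfl; exact lt_irrefl _ hr
    have hqr : q ≠ r := by rintro rfl; exact lt_irrefl _ hlt
    rcases (hext q).1 (by simp) with h | h | h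
    · exact absurd h hqp
    · subst h
      rcases (hext r).1 (by simp) with g | g | g
      · exact absurd g hrp
      · exact absurd g.symm hqr
      · subst g; rfl
    · subst h
      rcases (hext r).1 (by simp) with g | g | g
      · exact absurd g hrp
      · subst g; exact absurd hlt hlt'.not_gt
      · exact absurd g.symm hqr
  rw [← Finset.card_image_of_injOn hinj, numEmptyRainbowTriangles, ← Set.ncard_coe_finset]
  apply Set.ncard_le_ncard _ S.finite_emptyRainbowTriangles
  intro T hT
  simp only [Finset.coe_image, Set.mem_image] at hT
  obtain ⟨⟨p, q, r⟩, h, rfl⟩ := hT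
  simp only [Finset.coe_sigma, Set.mem_sigma_iff, Finset.mem_coe, radialPairs, before,
    Finset.mem_filter, Finset.mem_product] at h
  obtain ⟨hp, ⟨⟨hqS, hq⟩, hrS, hr⟩, hlt, c1, c2, c3, hcons⟩ := h
  have hqp : q ≠ p := by rintro rfl; exact lt_irrefl _ hq
  have hrp : r ≠ p := by rintro rfl; exact lt_irrefl _ hr
  have hqr : q ≠ r := by rintro rfl; exact lt_irrefl _ hlt
  have hpos : 0 < orient p q r := (orient_pos_iff_radial_lt hq hr).2 hlt
  refine ⟨⟨?_, ?_⟩, ?_, ?_⟩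
  · intro x hx
    simp only [f, Finset.mem_insert, Finset.mem_singleton] at hx
    rcases hx with rfl | rfl | rfl <;> assumption
  · exact Finset.card_eq_three.2 ⟨p, q, r, hqp.symm, hrp.symm, hqr, rfl⟩
  · intro x hx hmem
    simp only [f, Finset.coe_insert, Finset.coe_singleton] at hmem
    have g1 := orient_pos_of_mem_interior hpos hmem
    have g2 : 0 < orient r p x := by
      apply orient_pos_of_mem_interior (c := q)
      · rwa [← orient_rotate]
      · convert hmem using 3
        ext y; simp; tauto
    -- An interior point of the triangle would also precede `p`, and lie radially between `q` and
    -- `r`, which are consecutive.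
    have hle : φ x ≤ φ p := by
      have hsub : convexHull ℝ ({p, q, r} : Set Plane) ⊆ {y | φ y ≤ φ p} := by
        apply convexHull_min
        · intro y hy
          simp only [Set.mem_insert_iff, Set.mem_singleton_iff] at hy
          rw [Set.mem_ofPred_eq]
          rcases hy with rfl | rfl | rfl
          · exact le_rfl
          · exact hq.le
          · exact hr.le
        · intro y hy z hz s t hs ht hst
          have e : φ (s • y + t • z) = s * φ y + t * φ z := by
            simp only [hφ, PiLp.add_apply, PiLp.smul_apply, smul_eq_mul]
            ring
          simp only [Set.mem_ofPred_eq] at hy hz ⊢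
          rw [e]
          obtain rfl : s = 1 - t := by linarith
          nlinarith
      exact hsub (interior_subset hmem)
    have hxlt : φ x < φ p := by
      refine lt_of_le_of_ne hle fun h => ?_
      rw [hθ hx hp h] at g1
      have : orient p q p = 0 := by unfold orient; ring
      linarith
    refine hcons x ⟨hx, hxlt⟩ ⟨(orient_pos_iff_radial_lt hq hxlt).1 g1,
      (orient_pos_iff_radial_lt hxlt hr).1 ?_⟩
    rwa [orient_rotate x r p, orient_rotate p x r] at g2
  · intro x hx y hy hxy
    simp only [f, Finset.coe_insert, Finset.coe_singleton, Set.mem_insert_iff,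
      Set.mem_singleton_iff] at hx hy
    rcases hx with rfl | rfl | rfl <;> rcases hy with rfl | rfl | rfl <;>
      first | rfl | exact absurd hxy ‹_› | exact absurd hxy.symm ‹_›

/-- Mark the point of rank `a` in each color and order the colors by their marks. In a color
preceded by at least `R` others, every point of rank in `[a, b)` sees at least `R` other colors and
fewer than `b` points of its own color before it, hence has at least `R - b` rainbow radial pairs.
-/
theorem le_numEmptyRainbowTriangles (S : ColoredPointSet k m) {a b R : ℕ} (hab : a < b)
    (hbm : b ≤ m) : (k - R) * ((b - a) * (R - b)) ≤ S.numEmptyRainbowTriangles := by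
  classical
  obtain ⟨θ, hθ⟩ := exists_injOn_linear S.points
  set φ : Plane → ℝ := fun x => x 0 + θ * x 1 with hφ
  let B : Fin k → Finset Plane := fun c => S.points.filter (fun p => S.color p = c)
  have hBinj : ∀ c, Set.InjOn φ (B c) := fun c =>
    hθ.mono (Finset.coe_subset.2 (Finset.filter_subset _ _))
  have hBcard : ∀ c, (B c).card = m := S.card_colorClass
  have hmark : ∀ c, ∃ x ∈ B c, ((B c).filter (fun y => φ y < φ x)).card = a := by
    intro c
    have : a ∈ (B c).image (fun x => ((B c).filter (fun y => φ y < φ x)).card) := by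
      rw [image_rank (hBinj c), hBcard, Finset.mem_range]; omega
    simpa using this
  choose x hxB hxa using hmark
  have hxmem : ∀ c, x c ∈ S.points ∧ S.color (x c) = c := fun c => by
    simpa [B] using hxB c
  have hLinj : Set.InjOn (fun c => φ (x c)) (Finset.univ : Finset (Fin k)) := by
    intro c _ c' _ h
    rw [← (hxmem c).2, ← (hxmem c').2, hθ (hxmem c).1 (hxmem c').1 h]
  let late : Finset (Fin k) := Finset.univ.filter (fun c =>
    R ≤ (Finset.univ.filter (fun d => φ (x d) < φ (x c))).card ∧
      (Finset.univ.filter (fun d => φ (x d) < φ (x c))).card < k)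
  have hlate : late.card = k - R := card_filter_rank hLinj R (by simp)
  let Q : Fin k → Finset Plane := fun c => (B c).filter (fun p =>
    a ≤ ((B c).filter (fun y => φ y < φ p)).card ∧ ((B c).filter (fun y => φ y < φ p)).card < b)
  have hQ : ∀ c, (Q c).card = b - a := fun c => card_filter_rank (hBinj c) a (by rw [hBcard]; exact hbm)
  have hpt : ∀ c ∈ late, ∀ p ∈ Q c, R - b ≤ (S.radialPairs φ p).card := by
    intro c hc p hp
    simp only [late, Finset.mem_filter, Finset.mem_univ, true_and] at hc
    simp only [Q, Finset.mem_filter] at hp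
    obtain ⟨hpB, hpa, hpb⟩ := hp
    have hpS : p ∈ S.points ∧ S.color p = c := by simpa [B] using hpB
    have h := S.card_colors_before_le θ hpS.1
    rw [← hφ] at h
    have hown : ((S.before φ p).filter (fun y => S.color y = S.color p)).card < b := by
      convert hpb using 2
      ext y
      simp only [before, B, Finset.mem_filter, hpS.2]
      tauto
    have hxp : φ (x c) ≤ φ p := by
      by_contra! hlt
      have : ((B c).filter (fun y => φ y < φ p)).card < ((B c).filter (fun y => φ y < φ (x c))).card := by
        apply Finset.card_lt_card
        rw [Finset.ssubset_iff_of_subset]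
        · exact ⟨p, by simp [hpB, hlt], by simp⟩
        · intro z hz
          simp only [Finset.mem_filter] at hz ⊢
          exact ⟨hz.1, hz.2.trans hlt⟩
      rw [hxa] at this
      omega
    have hcol : (Finset.univ.filter (fun d => φ (x d) < φ (x c))).card ≤
        (((S.before φ p).image S.color).erase (S.color p)).card := by
      apply Finset.card_le_card
      intro d hd
      simp only [Finset.mem_filter, Finset.mem_univ, true_and] at hd
      rw [Finset.mem_erase, Finset.mem_image, hpS.2]
      refine ⟨by rintro rfl; exact lt_irrefl _ hd, x d, ?_, (hxmem d).2⟩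
      simp only [before, Finset.mem_filter]
      exact ⟨(hxmem d).1, hd.trans_le hxp⟩
    omega
  have hdisj : (late : Set (Fin k)).PairwiseDisjoint Q := by
    intro c _ c' _ hcc
    refine Finset.disjoint_left.2 fun p hp hp' => hcc ?_
    simp only [Q, B, Finset.mem_filter] at hp hp'
    exact hp.1.2.symm.trans hp'.1.2
  calc (k - R) * ((b - a) * (R - b))
      = ∑ c ∈ late, ∑ p ∈ Q c, (R - b) := by simp [hQ, hlate]
    _ ≤ ∑ c ∈ late, ∑ p ∈ Q c, (S.radialPairs φ p).card :=
        Finset.sum_le_sum fun c hc => Finset.sum_le_sum fun p hp => hpt c hc p hp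
    _ = ∑ p ∈ late.biUnion Q, (S.radialPairs φ p).card := (Finset.sum_biUnion hdisj).symm
    _ ≤ ∑ p ∈ S.points, (S.radialPairs φ p).card := by
        apply Finset.sum_le_sum_of_subset
        intro p hp
        simp only [Finset.mem_biUnion, Q, B, Finset.mem_filter] at hp
        obtain ⟨c, -, h, -⟩ := hp
        exact h.1
    _ ≤ _ := S.sum_card_radialPairs_le hθ

theorem sq_mul_min_le_numEmptyRainbowTriangles (S : ColoredPointSet k m) (hk : 3 ≤ k) :
    k ^ 2 * min m k ≤ 1000 * S.numEmptyRainbowTriangles := by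
  rcases Nat.eq_zero_or_pos m with rfl | hm
  · simp
  -- With `R` about `k / 2` and `b` at most about `k / 4`, the factors `k - R` and `R - b` are of
  -- order `k` and `b - a` is of order `min m k`.
  have h := S.le_numEmptyRainbowTriangles (a := min m ((k + 1) / 4) / 2)
    (b := min m ((k + 1) / 4)) (R := (k + 1) / 2) (by omega) (by omega)
  refine le_trans ?_ (Nat.mul_le_mul_left 1000 h)
  have h1 : k ≤ 3 * (k - (k + 1) / 2) := by omega
  have h2 : min m k ≤ 24 * (min m ((k + 1) / 4) - min m ((k + 1) / 4) / 2) := by omega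
  have h3 : k ≤ 6 * ((k + 1) / 2 - min m ((k + 1) / 4)) := by omega
  calc k ^ 2 * min m k = k * (min m k * k) := by ring
    _ ≤ (3 * (k - (k + 1) / 2)) * ((24 * (min m ((k + 1) / 4) - min m ((k + 1) / 4) / 2)) *
        (6 * ((k + 1) / 2 - min m ((k + 1) / 4)))) := by gcongr
    _ = 432 * ((k - (k + 1) / 2) * ((min m ((k + 1) / 4) - min m ((k + 1) / 4) / 2) *
        ((k + 1) / 2 - min m ((k + 1) / 4)))) := by ring
    _ ≤ _ := by gcongr; norm_num

end ColoredPointSet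

/-! ### Horton sets and their orientations. -/

/-- Heights of the points of a Horton set. -/
noncomputable def hortonHeight (η : ℝ) (n : ℕ) : ℝ :=
  if _h : n = 0 then 0 else (n % 2 : ℕ) + η * hortonHeight η (n / 2)
decreasing_by omega

theorem hortonHeight_eq (η : ℝ) (n : ℕ) :
    hortonHeight η n = (n % 2 : ℕ) + η * hortonHeight η (n / 2) := by
  rcases eq_or_ne n 0 with rfl | h
  · simp [hortonHeight]
  · rw [hortonHeight, dif_neg h]

theorem hortonHeight_mem {η : ℝ} (h0 : 0 < η) (h1 : η ≤ 1 / 2) (n : ℕ) :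
    0 ≤ hortonHeight η n ∧ hortonHeight η n ≤ 2 := by
  induction n using Nat.strong_induction_on with
  | _ n ih =>
    rcases eq_or_ne n 0 with rfl | h
    · simp [hortonHeight]
    · obtain ⟨g0, g1⟩ := ih (n / 2) (by omega)
      rw [hortonHeight_eq]
      have : ((n % 2 : ℕ) : ℝ) ≤ 1 := by exact_mod_cast (by omega : n % 2 ≤ 1)
      constructor
      · positivity
      · nlinarith

/-- The points of a Horton set, depending on a small parameter `η`. -/
noncomputable def hortonPoint (η : ℝ) (n : ℕ) : Plane := !₂[(n : ℝ), hortonHeight η n]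

theorem orient_hortonPoint (η : ℝ) (a b c : ℕ) :
    orient (hortonPoint η a) (hortonPoint η b) (hortonPoint η c) =
      ((b : ℝ) - a) * (hortonHeight η c - hortonHeight η a) -
        (hortonHeight η b - hortonHeight η a) * ((c : ℝ) - a) := by
  simp [orient, hortonPoint]

theorem hortonHeight_two_mul_add (η : ℝ) (n : ℕ) {b : ℕ} (hb : b < 2) :
    hortonHeight η (2 * n + b) = b + η * hortonHeight η n := by
  rw [hortonHeight_eq, show (2 * n + b) % 2 = b by omega, show (2 * n + b) / 2 = n by omega]

/-- Each parity class is the image of the whole set under the affine map `(x, y) ↦ (2 x + r, η y +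
r)`, of determinant `2 η`. This self-similarity drives all the inductions on halves. -/
theorem orient_hortonPoint_two_mul_add (η : ℝ) (a b c : ℕ) {r : ℕ} (hr : r < 2) :
    orient (hortonPoint η (2 * a + r)) (hortonPoint η (2 * b + r)) (hortonPoint η (2 * c + r)) =
      2 * η * orient (hortonPoint η a) (hortonPoint η b) (hortonPoint η c) := by
  simp only [orient_hortonPoint, hortonHeight_two_mul_add η _ hr]
  push_cast
  ring

theorem orient_hortonPoint_residue (η : ℝ) (a b c t : ℕ) {r : ℕ} (hr : r < 2 ^ t) :
    orient (hortonPoint η (r + 2 ^ t * a)) (hortonPoint η (r + 2 ^ t * b))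
        (hortonPoint η (r + 2 ^ t * c)) =
      (2 * η) ^ t * orient (hortonPoint η a) (hortonPoint η b) (hortonPoint η c) := by
  induction t generalizing r with
  | zero =>
    obtain rfl : r = 0 := by simpa using hr
    simp
  | succ t ih =>
    have e : ∀ x, r + 2 ^ (t + 1) * x = 2 * (r / 2 + 2 ^ t * x) + r % 2 := by
      intro x
      rw [pow_succ, mul_add, show 2 * (2 ^ t * x) = 2 ^ t * 2 * x by ring]
      omega
    rw [e, e, e, orient_hortonPoint_two_mul_add η _ _ _ (Nat.mod_lt _ two_pos),
      ih (by rw [pow_succ] at hr; omega)]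
    ring

/-- The parameter `η` is small compared to the number of points. -/
structure IsHortonParam (k : ℕ) (η : ℝ) : Prop where
  pos : 0 < η
  le_half : η ≤ 1 / 2
  lt : 4 * η * k < 1

theorem exists_isHortonParam (k : ℕ) : ∃ η, IsHortonParam k η := by
  refine ⟨1 / (4 * k + 4), by positivity, ?_, ?_⟩
  · rw [div_le_div_iff₀ (by positivity) (by positivity)]
    have : (0 : ℝ) ≤ k := k.cast_nonneg
    linarith
  · rw [mul_one_div, div_mul_eq_mul_div, div_lt_one (by positivity)]
    linarith

namespace IsHortonParam

variable {k : ℕ} {η : ℝ}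

/-- Heights are parities up to `O(η)`, so the orientation is an integer computed from parities plus
an error below `1`; a nonzero integer decides the sign. -/
theorem lead_error (h : IsHortonParam k η) {a b c : ℕ} (hab : a < b) (hbc : b < c) (hc : c < k) :
    ∃ e : ℝ, |e| < 1 ∧ orient (hortonPoint η a) (hortonPoint η b) (hortonPoint η c) =
      ((((b : ℤ) - a) * ((c % 2 : ℕ) - (a % 2 : ℕ)) -
        ((b % 2 : ℕ) - (a % 2 : ℕ)) * ((c : ℤ) - a) : ℤ) : ℝ) + e := by
  refine ⟨η * (((b : ℝ) - a) * (hortonHeight η (c / 2) - hortonHeight η (a / 2)) -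
        (hortonHeight η (b / 2) - hortonHeight η (a / 2)) * ((c : ℝ) - a)), ?_, ?_⟩
  · obtain ⟨a0, a1⟩ := hortonHeight_mem h.pos h.le_half (a / 2)
    obtain ⟨b0, b1⟩ := hortonHeight_mem h.pos h.le_half (b / 2)
    obtain ⟨c0, c1⟩ := hortonHeight_mem h.pos h.le_half (c / 2)
    have hη := h.pos
    have hlt := h.lt
    have hab' : (a : ℝ) < b := by exact_mod_cast hab
    have hbc' : (b : ℝ) < c := by exact_mod_cast hbc
    have hck : (c : ℝ) < k := by exact_mod_cast hc
    have ha : (0 : ℝ) ≤ a := a.cast_nonneg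
    rw [abs_mul, abs_of_pos hη]
    have h1 : |((b : ℝ) - a) * (hortonHeight η (c / 2) - hortonHeight η (a / 2))| ≤ k * 2 := by
      rw [abs_mul]
      apply mul_le_mul _ _ (abs_nonneg _) (by linarith) <;> rw [abs_le] <;> constructor <;> linarith
    have h2 : |(hortonHeight η (b / 2) - hortonHeight η (a / 2)) * ((c : ℝ) - a)| ≤ 2 * k := by
      rw [abs_mul]
      apply mul_le_mul _ _ (abs_nonneg _) (by norm_num) <;> rw [abs_le] <;> constructor <;> linarith
    calc _ ≤ η * (k * 2 + 2 * k) := by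
          gcongr
          exact (abs_sub _ _).trans (add_le_add h1 h2)
      _ < 1 := by linarith
  · rw [orient_hortonPoint, hortonHeight_eq η a, hortonHeight_eq η b, hortonHeight_eq η c]
    generalize a % 2 = a', b % 2 = b', c % 2 = c'
    push_cast
    ring

theorem orient_pos (h : IsHortonParam k η) {a b c : ℕ} (hab : a < b) (hbc : b < c) (hc : c < k)
    (hb : b % 2 = 0) (hac : a % 2 = 1 ∨ c % 2 = 1) :
    0 < orient (hortonPoint η a) (hortonPoint η b) (hortonPoint η c) := by
  obtain ⟨e, he, heq⟩ := h.lead_error hab hbc hc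
  have : (1 : ℤ) ≤ ((b : ℤ) - a) * ((c % 2 : ℕ) - (a % 2 : ℕ)) -
        ((b % 2 : ℕ) - (a % 2 : ℕ)) * ((c : ℤ) - a) := by
    rcases Nat.mod_two_eq_zero_or_one a with h1 | h1 <;>
      rcases Nat.mod_two_eq_zero_or_one c with h2 | h2 <;> rw [h1, h2, hb] <;> push_cast <;> omega
  have : (1 : ℝ) ≤ ((((b : ℤ) - a) * ((c % 2 : ℕ) - (a % 2 : ℕ)) -
        ((b % 2 : ℕ) - (a % 2 : ℕ)) * ((c : ℤ) - a) : ℤ) : ℝ) := by exact_mod_cast this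
  rw [heq]
  have := (abs_lt.1 he).1
  linarith

theorem orient_neg (h : IsHortonParam k η) {a b c : ℕ} (hab : a < b) (hbc : b < c) (hc : c < k)
    (hb : b % 2 = 1) (hac : a % 2 = 0 ∨ c % 2 = 0) :
    orient (hortonPoint η a) (hortonPoint η b) (hortonPoint η c) < 0 := by
  obtain ⟨e, he, heq⟩ := h.lead_error hab hbc hc
  have : ((b : ℤ) - a) * ((c % 2 : ℕ) - (a % 2 : ℕ)) -
        ((b % 2 : ℕ) - (a % 2 : ℕ)) * ((c : ℤ) - a) ≤ (-1 : ℤ) := by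
    rcases Nat.mod_two_eq_zero_or_one a with h1 | h1 <;>
      rcases Nat.mod_two_eq_zero_or_one c with h2 | h2 <;> rw [h1, h2, hb] <;> push_cast <;> omega
  have : ((((b : ℤ) - a) * ((c % 2 : ℕ) - (a % 2 : ℕ)) -
        ((b % 2 : ℕ) - (a % 2 : ℕ)) * ((c : ℤ) - a) : ℤ) : ℝ) ≤ -1 := by exact_mod_cast this
  rw [heq]
  have := (abs_lt.1 he).2
  linarith

/-- The Horton property: the even class lies below every line through two odd points, wherever its
abscissas fall. The next lemma is the mirror image. -/
theorem orient_of_even_odd_odd (h : IsHortonParam k η) {o x y : ℕ} (ho : o % 2 = 0)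
    (hx : x % 2 = 1) (hy : y % 2 = 1) (hxy : x < y) (hok : o < k) (hyk : y < k) :
    orient (hortonPoint η o) (hortonPoint η x) (hortonPoint η y) < 0 := by
  rcases lt_trichotomy o x with h1 | h1 | h1
  · exact h.orient_neg h1 hxy hyk hx (Or.inl ho)
  · omega
  · rcases lt_trichotomy o y with h2 | h2 | h2
    · have := h.orient_pos h1 h2 hyk ho (Or.inl hx)
      unfold orient at *; linarith
    · omega
    · have := h.orient_neg hxy h2 hok hy (Or.inr ho)
      unfold orient at *; linarith

theorem orient_of_odd_even_even (h : IsHortonParam k η) {o x y : ℕ} (ho : o % 2 = 1)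
    (hx : x % 2 = 0) (hy : y % 2 = 0) (hxy : x < y) (hok : o < k) (hyk : y < k) :
    0 < orient (hortonPoint η o) (hortonPoint η x) (hortonPoint η y) := by
  rcases lt_trichotomy o x with h1 | h1 | h1
  · exact h.orient_pos h1 hxy hyk hx (Or.inl ho)
  · omega
  · rcases lt_trichotomy o y with h2 | h2 | h2
    · have := h.orient_neg h1 h2 hyk ho (Or.inl hx)
      unfold orient at *; linarith
    · omega
    · have := h.orient_pos hxy h2 hok hy (Or.inr ho)
      unfold orient at *; linarith

/-- A positive orientation means that `r` is below the segment `p q`. An even index strictly between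
serves as `r` unless both ends are even; in that case halve both and recurse. The recursion ends at
consecutive indices, whence the dyadic form. -/
theorem dyadic_or_exists_below (h : IsHortonParam k η) {p q : ℕ} (hpq : p < q) (hq : q < k) :
    (∃ s u, q = p + 2 ^ s ∧ p = 2 ^ s * u) ∨ ∃ r, p < r ∧ r < q ∧
      0 < orient (hortonPoint η p) (hortonPoint η r) (hortonPoint η q) := by
  induction q using Nat.strong_induction_on generalizing p with
  | _ q ih =>
    rcases Nat.mod_two_eq_zero_or_one p with h1 | h1 <;>
      rcases Nat.mod_two_eq_zero_or_one q with h2 | h2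
    · rcases ih (q / 2) (by omega) (p := p / 2) (by omega) (by omega) with
        ⟨s, u, hs, hu⟩ | ⟨r, hr1, hr2, hr⟩
      · refine Or.inl ⟨s + 1, u, ?_, ?_⟩
        · rw [pow_succ]; omega
        · rw [pow_succ, mul_right_comm, ← hu]; omega
      · refine Or.inr ⟨2 * r, by omega, by omega, ?_⟩
        have := orient_hortonPoint_two_mul_add η (p / 2) r (q / 2) (r := 0) two_pos
        rw [show 2 * (p / 2) + 0 = p by omega, show 2 * (q / 2) + 0 = q by omega] at this
        rw [← add_zero (2 * r), this]
        have := h.pos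
        positivity
    · rcases (show q = p + 1 ∨ p + 2 < q by omega) with rfl | hlt
      · exact Or.inl ⟨0, p, by simp, by simp⟩
      · exact Or.inr ⟨p + 2, by omega, hlt, h.orient_pos (by omega) hlt hq (by omega) (Or.inr h2)⟩
    · rcases (show q = p + 1 ∨ p + 1 < q by omega) with rfl | hlt
      · exact Or.inl ⟨0, p, by simp, by simp⟩
      · exact Or.inr ⟨p + 1, by omega, hlt, h.orient_pos (by omega) hlt hq (by omega) (Or.inl h1)⟩
    · exact Or.inr ⟨p + 1, by omega, by omega,
        h.orient_pos (by omega) (by omega) hq (by omega) (Or.inl h1)⟩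

theorem dyadic_or_exists_above (h : IsHortonParam k η) {p q : ℕ} (hpq : p < q) (hq : q < k) :
    (∃ s u, q = p + 2 ^ s ∧ p + 1 = 2 ^ s * (u + 1)) ∨ ∃ r, p < r ∧ r < q ∧
      orient (hortonPoint η p) (hortonPoint η r) (hortonPoint η q) < 0 := by
  induction q using Nat.strong_induction_on generalizing p with
  | _ q ih =>
    rcases Nat.mod_two_eq_zero_or_one p with h1 | h1 <;>
      rcases Nat.mod_two_eq_zero_or_one q with h2 | h2
    · exact Or.inr ⟨p + 1, by omega, by omega,
        h.orient_neg (by omega) (by omega) hq (by omega) (Or.inl h1)⟩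
    · rcases (show q = p + 1 ∨ p + 1 < q by omega) with rfl | hlt
      · exact Or.inl ⟨0, p, by simp, by simp⟩
      · exact Or.inr ⟨p + 1, by omega, hlt, h.orient_neg (by omega) hlt hq (by omega) (Or.inl h1)⟩
    · rcases (show q = p + 1 ∨ p + 2 < q by omega) with rfl | hlt
      · exact Or.inl ⟨0, p, by simp, by simp⟩
      · exact Or.inr ⟨p + 2, by omega, hlt, h.orient_neg (by omega) hlt hq (by omega) (Or.inr h2)⟩
    · rcases ih (q / 2) (by omega) (p := p / 2) (by omega) (by omega) with
        ⟨s, u, hs, hu⟩ | ⟨r, hr1, hr2, hr⟩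
      · refine Or.inl ⟨s + 1, u, ?_, ?_⟩
        · rw [pow_succ]; omega
        · rw [pow_succ, mul_right_comm, ← hu]; omega
      · refine Or.inr ⟨2 * r + 1, by omega, by omega, ?_⟩
        have := orient_hortonPoint_two_mul_add η (p / 2) r (q / 2) (r := 1) one_lt_two
        rw [show 2 * (p / 2) + 1 = p by omega, show 2 * (q / 2) + 1 = q by omega] at this
        rw [this]
        exact mul_neg_of_pos_of_neg (by have := h.pos; positivity) hr

end IsHortonParam

/-! ### Empty triangles of a Horton set. -/

/-- Three distinct naturals share a residue modulo a power of two, and the quotients have the form: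
one (`o`) has parity different from the other two (`p < q`). -/
structure IsDyadicSplit (t r o p q : ℕ) : Prop where
  residue_lt : r < 2 ^ t
  lt : p < q
  parity_eq : p % 2 = q % 2
  parity_ne : o % 2 ≠ p % 2

theorem exists_isDyadicSplit_of_parity_ne {a b c : ℕ} (hab : a ≠ b) (hac : a ≠ c) (hbc : b ≠ c)
    (h : ¬ (a % 2 = b % 2 ∧ b % 2 = c % 2)) :
    ∃ o p q, IsDyadicSplit 0 0 o p q ∧ ({a, b, c} : Finset ℕ) = {o, p, q} := by
  rcases (show (a % 2 = b % 2 ∧ c % 2 ≠ a % 2) ∨ (a % 2 = c % 2 ∧ b % 2 ≠ a % 2) ∨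
    (b % 2 = c % 2 ∧ a % 2 ≠ b % 2) by omega) with ⟨h1, h2⟩ | ⟨h1, h2⟩ | ⟨h1, h2⟩
  · rcases hab.lt_or_gt with hl | hl
    · exact ⟨c, a, b, ⟨by simp, hl, h1, h2⟩, by ext; simp; tauto⟩
    · exact ⟨c, b, a, ⟨by simp, hl, h1.symm, by omega⟩, by ext; simp; tauto⟩
  · rcases hac.lt_or_gt with hl | hl
    · exact ⟨b, a, c, ⟨by simp, hl, h1, h2⟩, by ext; simp; tauto⟩
    · exact ⟨b, c, a, ⟨by simp, hl, h1.symm, by omega⟩, by ext; simp; tauto⟩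
  · rcases hbc.lt_or_gt with hl | hl
    · exact ⟨a, b, c, ⟨by simp, hl, h1, h2⟩, by ext; simp⟩
    · exact ⟨a, c, b, ⟨by simp, hl, h1.symm, by omega⟩, by ext; simp; tauto⟩

/-- Strip common low bits until the parities disagree; then exactly two of the three agree. -/
theorem exists_isDyadicSplit {a b c : ℕ} (hab : a ≠ b) (hac : a ≠ c) (hbc : b ≠ c) :
    ∃ t r o p q, IsDyadicSplit t r o p q ∧
      ({a, b, c} : Finset ℕ) = {r + 2 ^ t * o, r + 2 ^ t * p, r + 2 ^ t * q} := by
  induction hn : a + b + c using Nat.strong_induction_on generalizing a b c with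
  | _ n ih =>
    by_cases h : a % 2 = b % 2 ∧ b % 2 = c % 2
    · obtain ⟨t, r, o, p, q, hs, he⟩ := ih (a / 2 + b / 2 + c / 2) (by omega)
        (a := a / 2) (b := b / 2) (c := c / 2) (by omega) (by omega) (by omega) rfl
      refine ⟨t + 1, 2 * r + a % 2, o, p, q,
        ⟨by have := hs.residue_lt; rw [pow_succ]; omega, hs.lt, hs.parity_eq, hs.parity_ne⟩, ?_⟩
      have key := congrArg (Finset.image (fun x => 2 * x + a % 2)) he
      simp only [Finset.image_insert, Finset.image_singleton] at key
      rw [show 2 * (a / 2) + a % 2 = a by omega, show 2 * (b / 2) + a % 2 = b by omega,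
        show 2 * (c / 2) + a % 2 = c by omega] at key
      rw [key]
      have e : ∀ x, 2 * (r + 2 ^ t * x) + a % 2 = 2 * r + a % 2 + 2 ^ (t + 1) * x := by
        intro x; ring
      rw [e, e, e]
    · obtain ⟨o, p, q, hs, he⟩ := exists_isDyadicSplit_of_parity_ne hab hac hbc h
      exact ⟨0, 0, o, p, q, hs, by simpa using he⟩

/-- `d` lies inside the triangle `a b c`, in terms of orientations. -/
def OrientInside (a b c d : Plane) : Prop :=
  ∃ σ : ℝ, 0 < σ * orient a b c ∧ 0 < σ * orient a b d ∧ 0 < σ * orient b c d ∧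
    0 < σ * orient c a d

/-- The vertex `o` lies beyond every line through two points of the class of `p` and `q`. Hence a
point of that class between `p` and `q`, on the side of `o`, would be inside the triangle. So the
segment is free below or above within its class, and the dyadic form of the halves applies: `p` odd
gives the first congruence, `p` even the second. -/
theorem IsHortonParam.dyadic_of_empty {k : ℕ} {η : ℝ} (h : IsHortonParam k η) {t r o p q : ℕ}
    (hs : IsDyadicSplit t r o p q) (ho : r + 2 ^ t * o < k) (hq : r + 2 ^ t * q < k)
    (hempty : ∀ d < k, ¬ OrientInside (hortonPoint η (r + 2 ^ t * o))
      (hortonPoint η (r + 2 ^ t * p)) (hortonPoint η (r + 2 ^ t * q)) (hortonPoint η d)) :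
    ∃ s u, q = p + 2 ^ (s + 1) ∧
      (p = 1 + 2 ^ (s + 1) * u ∨ p = 2 ^ (s + 1) - 2 + 2 ^ (s + 1) * u) := by
  obtain ⟨hr, hlt, hpar, hne⟩ := hs
  have hle : ∀ x, x ≤ r + 2 ^ t * x := fun x =>
    (Nat.le_mul_of_pos_left x (by positivity)).trans (Nat.le_add_left _ _)
  have hη : 0 < (2 * η) ^ t := by have := h.pos; positivity
  have hok := (hle o).trans_lt ho
  have hqk := (hle q).trans_lt hq
  rcases Nat.mod_two_eq_zero_or_one p with hp2 | hp2
  · rcases h.dyadic_or_exists_above (p := p / 2) (q := q / 2) (by omega) (by omega) with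
      ⟨s, u, e1, e2⟩ | ⟨d, hd1, hd2, hd⟩
    · refine ⟨s, u, by rw [pow_succ]; omega, Or.inr ?_⟩
      have : 0 < 2 ^ s := by positivity
      rw [mul_add, mul_one] at e2
      rw [pow_succ, mul_right_comm]
      omega
    · exfalso
      refine hempty (r + 2 ^ t * (2 * d)) (lt_of_le_of_lt ?_ hq) ⟨1, ?_, ?_, ?_, ?_⟩
      · gcongr; omega
      all_goals rw [one_mul, orient_hortonPoint_residue η _ _ _ t hr]; apply mul_pos hη
      · exact h.orient_of_odd_even_even (by omega) hp2 (by omega) hlt hok hqk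
      · exact h.orient_of_odd_even_even (by omega) hp2 (by omega) (by omega) hok (by omega)
      · have := orient_hortonPoint_two_mul_add η (p / 2) d (q / 2) (r := 0) two_pos
        rw [show 2 * (p / 2) + 0 = p by omega, show 2 * (q / 2) + 0 = q by omega, add_zero] at this
        rw [orient_swap, this]
        have := mul_neg_of_pos_of_neg (by have := h.pos; positivity : 0 < 2 * η) hd
        linarith
      · rw [← orient_rotate]
        exact h.orient_of_odd_even_even (by omega) (by omega) (by omega) (by omega) hok hqk
  · rcases h.dyadic_or_exists_below (p := p / 2) (q := q / 2) (by omega) (by omega) with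
      ⟨s, u, e1, e2⟩ | ⟨d, hd1, hd2, hd⟩
    · refine ⟨s, u, by rw [pow_succ]; omega, Or.inl ?_⟩
      rw [pow_succ, mul_right_comm]
      omega
    · exfalso
      refine hempty (r + 2 ^ t * (2 * d + 1)) (lt_of_le_of_lt ?_ hq) ⟨-1, ?_, ?_, ?_, ?_⟩
      · gcongr; omega
      all_goals rw [neg_one_mul, orient_hortonPoint_residue η _ _ _ t hr, ← mul_neg];
                apply mul_pos hη; apply neg_pos.2
      · exact h.orient_of_even_odd_odd (by omega) hp2 (by omega) hlt hok hqk
      · exact h.orient_of_even_odd_odd (by omega) hp2 (by omega) (by omega) hok (by omega)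
      · have := orient_hortonPoint_two_mul_add η (p / 2) d (q / 2) (r := 1) one_lt_two
        rw [show 2 * (p / 2) + 1 = p by omega, show 2 * (q / 2) + 1 = q by omega] at this
        rw [orient_swap, this]
        have := mul_pos (by have := h.pos; positivity : 0 < 2 * η) hd
        linarith
      · rw [← orient_rotate]
        exact h.orient_of_even_odd_odd (by omega) (by omega) (by omega) (by omega) hok hqk

theorem IsHortonParam.orient_ne_zero {k : ℕ} {η : ℝ} (h : IsHortonParam k η) {a b c : ℕ}
    (hab : a ≠ b) (hac : a ≠ c) (hbc : b ≠ c) (ha : a < k) (hb : b < k) (hc : c < k) :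
    orient (hortonPoint η a) (hortonPoint η b) (hortonPoint η c) ≠ 0 := by
  induction hn : a + b + c using Nat.strong_induction_on generalizing a b c with
  | _ n ih =>
    by_cases hpar : a % 2 = b % 2 ∧ b % 2 = c % 2
    · have := orient_hortonPoint_two_mul_add η (a / 2) (b / 2) (c / 2)
        (Nat.mod_lt a two_pos)
      rw [show 2 * (a / 2) + a % 2 = a by omega, show 2 * (b / 2) + a % 2 = b by omega,
        show 2 * (c / 2) + a % 2 = c by omega] at this
      rw [this]
      have := h.pos
      exact mul_ne_zero (by positivity) (ih (a / 2 + b / 2 + c / 2) (by omega) (by omega)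
        (by omega) (by omega) (by omega) (by omega) (by omega) rfl)
    · have sorted : ∀ x y z : ℕ, x < y → y < z → z < k → ¬ (x % 2 = y % 2 ∧ y % 2 = z % 2) →
          orient (hortonPoint η x) (hortonPoint η y) (hortonPoint η z) ≠ 0 := by
        intro x y z hxy hyz hz hp
        rcases Nat.mod_two_eq_zero_or_one y with hy | hy
        · exact (h.orient_pos hxy hyz hz hy (by omega)).ne'
        · exact (h.orient_neg hxy hyz hz hy (by omega)).ne
      intro h0
      rcases (show (a < b ∧ b < c) ∨ (a < c ∧ c < b) ∨ (b < a ∧ a < c) ∨ (b < c ∧ c < a) ∨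
        (c < a ∧ a < b) ∨ (c < b ∧ b < a) by omega) with
        ⟨h1, h2⟩ | ⟨h1, h2⟩ | ⟨h1, h2⟩ | ⟨h1, h2⟩ | ⟨h1, h2⟩ | ⟨h1, h2⟩ <;>
      · refine sorted _ _ _ h1 h2 (by assumption) (by omega) ?_
        unfold orient at *
        linarith

/-! ### Replacing each point by a shrinking cluster. -/

open Filter Topology

/-- The cross product of two vectors of the plane. -/
def cross (u v : Plane) : ℝ := u 0 * v 1 - u 1 * v 0

theorem orient_eq_cross (p q r : Plane) : orient p q r = cross (q - p) (r - p) := by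
  simp [orient, cross]

/-- The rotation of the plane by a right angle. -/
def quarterTurn (v : Plane) : Plane := !₂[-v 1, v 0]

theorem cross_quarterTurn_pos {v : Plane} (hv : v ≠ 0) : 0 < cross v (quarterTurn v) := by
  have h : v 0 ≠ 0 ∨ v 1 ≠ 0 := by
    by_contra! h
    apply hv
    ext i
    fin_cases i
    · exact h.1
    · exact h.2
  have e : cross v (quarterTurn v) = v 0 ^ 2 + v 1 ^ 2 := by
    simp [cross, quarterTurn]; ring
  rw [e]
  rcases h with h | h <;> positivity

theorem eventually_mul_pos {F : ℝ → ℝ} (hF : Continuous F) (h0 : F 0 ≠ 0) :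
    ∀ᶠ x in 𝓝[>] (0 : ℝ), 0 < F x * F 0 := by
  have : Continuous fun x => F x * F 0 := by fun_prop
  exact (this.continuousAt.eventually_const_lt (mul_self_pos.2 h0)).filter_mono nhdsWithin_le_nhds

/-- Pairwise distinct real numbers with alternating signs. -/
def altSlope (i : ℕ) : ℝ := (-1) ^ i * (i + 1)

theorem altSlope_injective : Function.Injective altSlope := by
  intro i j h
  have := congrArg abs h
  simp only [altSlope, abs_mul, abs_pow, abs_neg, abs_one, one_pow, one_mul] at this
  rw [abs_of_pos (by positivity), abs_of_pos (by positivity)] at this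
  exact_mod_cast add_right_cancel this

theorem altSlope_even_pos (g : ℕ) : 0 < altSlope (2 * g) := by
  rw [altSlope, pow_mul, neg_one_sq, one_pow, one_mul]
  positivity

theorem altSlope_odd_neg (g : ℕ) : altSlope (2 * g + 1) < 0 := by
  rw [altSlope, pow_succ, pow_mul, neg_one_sq, one_pow, one_mul, neg_one_mul, neg_neg_iff_pos]
  positivity

/-- The direction `d c i` is the vector to the target of index `i / 2`, tilted by `δ * altSlope i`.
For small `δ` the tilt crosses no other `H a`; alternating signs put members `2 * g` and `2 * g + 1`
on opposite sides of the target, and distinct slopes prevent parallel directions. -/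
theorem exists_directions {k : ℕ} (m : ℕ) {H : Fin k → Plane}
    (hH : ∀ a b c, a ≠ b → a ≠ c → b ≠ c → orient (H a) (H b) (H c) ≠ 0)
    (hinj : Function.Injective H)
    (tgt : Fin k → ℕ → Fin k) (htgt : ∀ c g, tgt c g ≠ c) :
    ∃ d : Fin k → Fin m → Plane,
      (∀ c (i : Fin m), 0 < altSlope i * cross (H (tgt c (i / 2)) - H c) (d c i)) ∧
      (∀ c (i : Fin m) a, a ≠ c → a ≠ tgt c (i / 2) →
        0 < cross (d c i) (H a - H c) * orient (H c) (H (tgt c (i / 2))) (H a)) ∧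
      ∀ c i j, i ≠ j → cross (d c i) (d c j) ≠ 0 := by
  let v : Fin k → Fin m → Plane := fun c i => H (tgt c (i / 2)) - H c
  let D : ℝ → Fin k → Fin m → Plane := fun δ c i => v c i + (δ * altSlope i) • quarterTurn (v c i)
  have hv : ∀ c i, v c i ≠ 0 := fun c i => sub_ne_zero.2 (hinj.ne (htgt _ _))
  have h2 : ∀ᶠ δ in 𝓝[>] (0 : ℝ), ∀ c (i : Fin m) a, a ≠ c → a ≠ tgt c (i / 2) →
      0 < cross (D δ c i) (H a - H c) * orient (H c) (H (tgt c (i / 2))) (H a) := by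
    simp only [eventually_all]
    intro c i a h1 h2
    have := eventually_mul_pos (F := fun δ => cross (D δ c i) (H a - H c))
      (by simp only [cross, D, PiLp.add_apply, PiLp.smul_apply]; fun_prop)
      (by
        have := hH c (tgt c (i / 2)) a (htgt _ _).symm h1.symm h2.symm
        rw [orient_eq_cross] at this
        simpa [D, v] using this)
    filter_upwards [this] with δ hδ
    rw [orient_eq_cross]
    simpa [D, v] using hδ
  have h3 : ∀ᶠ δ in 𝓝[>] (0 : ℝ), ∀ c i j, i ≠ j → cross (D δ c i) (D δ c j) ≠ 0 := by
    simp only [eventually_all]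
    intro c i j hij
    by_cases htt : tgt c (i / 2) = tgt c (j / 2)
    · filter_upwards [self_mem_nhdsWithin] with δ hδ
      have e : cross (D δ c i) (D δ c j) =
          δ * (altSlope j - altSlope i) * cross (v c j) (quarterTurn (v c j)) := by
        simp only [D, v, htt, cross, quarterTurn]
        simp
        ring
      rw [e]
      refine mul_ne_zero (mul_ne_zero (ne_of_gt hδ) (sub_ne_zero.2 fun h => ?_))
        (cross_quarterTurn_pos (hv c j)).ne'
      exact hij (Fin.ext (altSlope_injective h)).symm
    · have := eventually_mul_pos (F := fun δ => cross (D δ c i) (D δ c j))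
        (by simp only [cross, D, PiLp.add_apply, PiLp.smul_apply]; fun_prop)
        (by
          have := hH c (tgt c (i / 2)) (tgt c (j / 2)) (htgt _ _).symm (htgt _ _).symm htt
          rw [orient_eq_cross] at this
          simpa [D, v] using this)
      filter_upwards [this] with δ hδ
      exact left_ne_zero_of_mul hδ.ne'
  obtain ⟨δ, ⟨g2, g3⟩, hδ⟩ := ((h2.and h3).and self_mem_nhdsWithin).exists
  refine ⟨D δ, fun c i => ?_, g2, g3⟩
  have e : altSlope i * cross (v c i) (D δ c i) =
      δ * altSlope i ^ 2 * cross (v c i) (quarterTurn (v c i)) := by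
    simp [D, cross, quarterTurn]
    ring
  have ht : altSlope i ≠ 0 := by
    unfold altSlope; positivity
  change 0 < altSlope i * cross (v c i) (D δ c i)
  rw [e]
  have := cross_quarterTurn_pos (hv c i)
  have : 0 < δ := hδ
  positivity

/-- Member `i` sits at scale `ε ^ (i + 1)`. Seen from a later member `j`, it therefore appears in
direction `d c i`, while other clusters appear in the direction of their centers. Dividing by the
leading power of `ε`, each orientation has a nonzero limit. -/
theorem exists_clusters {k : ℕ} (m : ℕ) {H : Fin k → Plane}
    (hH : ∀ a b c, a ≠ b → a ≠ c → b ≠ c → orient (H a) (H b) (H c) ≠ 0)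
    {d : Fin k → Fin m → Plane} (hd : ∀ c i a, a ≠ c → cross (d c i) (H a - H c) ≠ 0)
    (hdd : ∀ c i j, i ≠ j → cross (d c i) (d c j) ≠ 0) :
    ∃ P : Fin k → Fin m → Plane,
      (∀ a b c i j l, a ≠ b → a ≠ c → b ≠ c →
        0 < orient (P a i) (P b j) (P c l) * orient (H a) (H b) (H c)) ∧
      (∀ c a i j l, a ≠ c → i < j →
        0 < orient (P c j) (P c i) (P a l) * cross (d c i) (H a - H c)) ∧
      ∀ c i j l, i < j → j < l → orient (P c l) (P c i) (P c j) ≠ 0 := by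
  let P : ℝ → Fin k → Fin m → Plane := fun ε c i => H c + ε ^ (i.1 + 1) • d c i
  have h1 : ∀ᶠ ε in 𝓝[>] (0 : ℝ), ∀ a b c i j l, a ≠ b → a ≠ c → b ≠ c →
      0 < orient (P ε a i) (P ε b j) (P ε c l) * orient (H a) (H b) (H c) := by
    simp only [eventually_all]
    intro a b c i j l hab hac hbc
    have := eventually_mul_pos (F := fun ε => orient (P ε a i) (P ε b j) (P ε c l))
      (by simp only [orient, P, PiLp.add_apply, PiLp.smul_apply]; fun_prop)
      (by simpa [P] using hH a b c hab hac hbc)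
    filter_upwards [this] with ε hε
    simpa [P] using hε
  have h2 : ∀ᶠ ε in 𝓝[>] (0 : ℝ), ∀ c a i j l, a ≠ c → i < j →
      0 < orient (P ε c j) (P ε c i) (P ε a l) * cross (d c i) (H a - H c) := by
    simp only [eventually_all]
    intro c a i j l hac hij
    have hne : j.1 - i.1 ≠ 0 := by have : i.1 < j.1 := hij; omega
    have := eventually_mul_pos
      (F := fun ε => cross (d c i - ε ^ (j.1 - i.1) • d c j) (P ε a l - P ε c j))
      (by simp only [cross, P, PiLp.add_apply, PiLp.smul_apply, PiLp.sub_apply]; fun_prop)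
      (by simpa [P, hne] using hd c i a hac)
    filter_upwards [this, self_mem_nhdsWithin] with ε hε h0
    have e : orient (P ε c j) (P ε c i) (P ε a l) =
        ε ^ (i.1 + 1) * cross (d c i - ε ^ (j.1 - i.1) • d c j) (P ε a l - P ε c j) := by
      have hp : ε ^ (j.1 + 1) = ε ^ (i.1 + 1) * ε ^ (j.1 - i.1) := by
        rw [← pow_add]; congr 1; omega
      rw [orient_eq_cross]
      simp only [P, cross, PiLp.add_apply, PiLp.smul_apply, PiLp.sub_apply, smul_eq_mul, hp]
      ring
    have h0' : 0 < ε ^ (i.1 + 1) := pow_pos h0 _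
    rw [e, mul_assoc]
    exact mul_pos h0' (by simpa [P, hne] using hε)
  have h3 : ∀ᶠ ε in 𝓝[>] (0 : ℝ), ∀ c i j l, i < j → j < l →
      orient (P ε c l) (P ε c i) (P ε c j) ≠ 0 := by
    simp only [eventually_all]
    intro c i j l hij hjl
    have hne : l.1 - i.1 ≠ 0 := by have : i.1 < l.1 := hij.trans hjl; omega
    have hne' : l.1 - j.1 ≠ 0 := by have : j.1 < l.1 := hjl; omega
    have := eventually_mul_pos
      (F := fun ε => cross (d c i - ε ^ (l.1 - i.1) • d c l) (d c j - ε ^ (l.1 - j.1) • d c l))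
      (by simp only [cross, PiLp.smul_apply, PiLp.sub_apply]; fun_prop)
      (by simpa [hne, hne'] using hdd c i j hij.ne)
    filter_upwards [this, self_mem_nhdsWithin] with ε hε h0
    have e : orient (P ε c l) (P ε c i) (P ε c j) = ε ^ (i.1 + 1) * ε ^ (j.1 + 1) *
        cross (d c i - ε ^ (l.1 - i.1) • d c l) (d c j - ε ^ (l.1 - j.1) • d c l) := by
      have hp : ε ^ (l.1 + 1) = ε ^ (i.1 + 1) * ε ^ (l.1 - i.1) := by
        rw [← pow_add]; congr 1; omega
      have hp' : ε ^ (l.1 + 1) = ε ^ (j.1 + 1) * ε ^ (l.1 - j.1) := by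
        rw [← pow_add]; congr 1; omega
      have e1 : P ε c i - P ε c l = ε ^ (i.1 + 1) • (d c i - ε ^ (l.1 - i.1) • d c l) := by
        simp only [P, smul_sub, smul_smul, ← hp]; abel
      have e2 : P ε c j - P ε c l = ε ^ (j.1 + 1) • (d c j - ε ^ (l.1 - j.1) • d c l) := by
        simp only [P, smul_sub, smul_smul, ← hp']; abel
      rw [orient_eq_cross, e1, e2]
      simp only [cross, PiLp.smul_apply, PiLp.sub_apply, smul_eq_mul]
      ring
    have h0' : ε ≠ 0 := ne_of_gt h0
    rw [e]
    exact mul_ne_zero (by positivity) (left_ne_zero_of_mul hε.ne')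
  obtain ⟨ε, ⟨g1, g2⟩, g3⟩ := ((h1.and h2).and h3).exists
  exact ⟨P ε, g1, g2, g3⟩

/-- For the last clause: seen from `P c j`, the earlier members `2 * g` and `2 * g + 1` lie just to
either side of the `g`-th target. One of them is inside the angle towards `a`, and so close to its
apex that it is inside the triangle. -/
theorem exists_cluster_blowup {k : ℕ} (m : ℕ) {H : Fin k → Plane}
    (hH : ∀ a b c, a ≠ b → a ≠ c → b ≠ c → orient (H a) (H b) (H c) ≠ 0)
    (hinj : Function.Injective H)
    (tgt : Fin k → ℕ → Fin k) (htgt : ∀ c g, tgt c g ≠ c) :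
    ∃ P : Fin k → Fin m → Plane,
      (∀ a b c i j l, a ≠ b → a ≠ c → b ≠ c →
        0 < orient (P a i) (P b j) (P c l) * orient (H a) (H b) (H c)) ∧
      (∀ c i j a l, a ≠ c → i ≠ j → orient (P c i) (P c j) (P a l) ≠ 0) ∧
      (∀ c i j l, i ≠ j → i ≠ l → j ≠ l → orient (P c i) (P c j) (P c l) ≠ 0) ∧
      ∀ c g (j : Fin m) a, a ≠ c → a ≠ tgt c g → 2 * g + 2 ≤ j.1 → ∀ y l, ∃ i,
        OrientInside (P c j) (P (tgt c g) y) (P a l) (P c i) := by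
  obtain ⟨d, d1, d2, d3⟩ := exists_directions m hH hinj tgt htgt
  have cross_swap : ∀ u v, cross u v = -cross v u := fun u v => by unfold cross; ring
  have hd : ∀ c i a, a ≠ c → cross (d c i) (H a - H c) ≠ 0 := by
    intro c i a hac
    by_cases h : a = tgt c (i / 2)
    · subst h
      have := d1 c i
      rw [cross_swap]
      exact neg_ne_zero.2 (right_ne_zero_of_mul this.ne')
    · exact left_ne_zero_of_mul (d2 c i a hac h).ne'
  obtain ⟨P, p1, p2, p3⟩ := exists_clusters m hH hd d3
  refine ⟨P, p1, ?_, ?_, ?_⟩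
  · intro c i j a l hac hij h0
    rcases hij.lt_or_gt with h | h
    · have := p2 c a i j l hac h
      rw [show orient (P c j) (P c i) (P a l) = 0 by unfold orient at *; linarith] at this
      simp at this
    · have := p2 c a j i l hac h
      rw [h0] at this
      simp at this
  · intro c i j l hij hil hjl h0
    rcases hij.lt_or_gt with h | h <;> rcases hil.lt_or_gt with h' | h' <;>
      rcases hjl.lt_or_gt with h'' | h''
    · exact p3 c _ _ _ h h'' (by unfold orient at *; linarith)
    · exact p3 c _ _ _ h' h'' (by unfold orient at *; linarith)
    · exact absurd (h.trans h'') h'.not_gt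
    · exact p3 c _ _ _ h' h (by unfold orient at *; linarith)
    · exact p3 c _ _ _ h h' (by unfold orient at *; linarith)
    · exact absurd (h.trans h') h''.not_gt
    · exact p3 c _ _ _ h'' h' (by unfold orient at *; linarith)
    · exact p3 c _ _ _ h'' h (by unfold orient at *; linarith)
  · intro c g j a hac hag hj y l
    set b := tgt c g with hb
    have hbc : b ≠ c := htgt c g
    have main : ∀ i : Fin m, i < j → i.1 / 2 = g →
        0 < altSlope i * orient (H c) (H b) (H a) →
        OrientInside (P c j) (P b y) (P a l) (P c i) := by
      intro i hij hig hs
      have q1 := d1 c i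
      have q2 := d2 c i a hac (by rw [hig]; exact hag)
      rw [hig, ← hb] at q1 q2
      have r1 := p2 c b i j y hbc hij
      have r2 := p2 c a i j l hac hij
      have r3 := p1 c b a j y l hbc.symm hac.symm hag.symm
      have r4 := p1 c b a i y l hbc.symm hac.symm hag.symm
      set W := orient (H c) (H b) (H a)
      refine ⟨W, by linarith, ?_, ?_, ?_⟩
      · have e1 : orient (P c j) (P b y) (P c i) = -orient (P c j) (P c i) (P b y) := orient_swap _ _ _
        have e2 := cross_swap (d c i) (H b - H c)
        rw [e1]
        rw [e2] at r1
        rcases lt_trichotomy (altSlope i) 0 with h | h | h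
        · have a1 := neg_of_mul_pos_right hs h.le
          have a2 := neg_of_mul_pos_right q1 h.le
          have : 0 < orient (P c j) (P c i) (P b y) := pos_of_mul_pos_left r1 (by linarith)
          nlinarith
        · simp [h] at hs
        · have a1 := pos_of_mul_pos_right hs h.le
          have a2 := pos_of_mul_pos_right q1 h.le
          have : orient (P c j) (P c i) (P b y) < 0 := neg_of_mul_pos_left r1 (by linarith)
          nlinarith
      · rw [orient_rotate, mul_comm]; exact r4
      · rw [← orient_rotate]
        rcases lt_trichotomy W 0 with h | h | h
        · have a1 := neg_of_mul_pos_left q2 h.le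
          have := neg_of_mul_pos_left r2 a1.le
          nlinarith
        · simp [h] at hs
        · have a1 := pos_of_mul_pos_left q2 h.le
          have := pos_of_mul_pos_left r2 a1.le
          nlinarith
    -- The side of `a` relative to the line from `c` to `b` selects which of the two tilted members
    -- is used.
    rcases (hH c b a hbc.symm hac.symm hag.symm).lt_or_gt with h | h
    · refine ⟨⟨2 * g + 1, by omega⟩, main _ (by rw [Fin.lt_def]; simp only; omega)
        (by simp only; omega) ?_⟩
      exact mul_pos_of_neg_of_neg (altSlope_odd_neg g) h
    · refine ⟨⟨2 * g, by omega⟩, main _ (by rw [Fin.lt_def]; simp only; omega)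
        (by simp only; omega) ?_⟩
      exact mul_pos (altSlope_even_pos g) h

theorem OrientInside.rotate {a b c d : Plane} (h : OrientInside a b c d) :
    OrientInside b c a d := by
  obtain ⟨σ, h1, h2, h3, h4⟩ := h
  exact ⟨σ, by rwa [orient_rotate], h3, h4, h2⟩

theorem OrientInside.swap {a b c d : Plane} (h : OrientInside a b c d) :
    OrientInside a c b d := by
  obtain ⟨σ, h1, h2, h3, h4⟩ := h
  refine ⟨-σ, ?_, ?_, ?_, ?_⟩ <;> unfold orient at * <;> linarith

theorem OrientInside.mem_interior {a b c d : Plane} (h : OrientInside a b c d) :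
    d ∈ interior (convexHull ℝ ({a, b, c} : Set Plane)) := by
  obtain ⟨σ, -, h2, h3, h4⟩ := h
  exact mem_interior_triangle_of_mul_pos σ h2 h3 h4

theorem OrientInside.ne {a b c d : Plane} (h : OrientInside a b c d) : d ≠ a ∧ d ≠ b ∧ d ≠ c := by
  obtain ⟨σ, -, h2, h3, h4⟩ := h
  refine ⟨?_, ?_, ?_⟩ <;> rintro rfl
  · have : orient d b d = 0 := by unfold orient; ring
    simp [this] at h2
  · have : orient a d d = 0 := by unfold orient; ring
    simp [this] at h2
  · have : orient b d d = 0 := by unfold orient; ring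
    simp [this] at h3

theorem OrientInside.of_mul_pos {a b c d a' b' c' d' : Plane} (h : OrientInside a b c d)
    (h1 : 0 < orient a' b' c' * orient a b c) (h2 : 0 < orient a' b' d' * orient a b d)
    (h3 : 0 < orient b' c' d' * orient b c d) (h4 : 0 < orient c' a' d' * orient c a d) :
    OrientInside a' b' c' d' := by
  have key : ∀ σ x y : ℝ, 0 < σ * y → 0 < x * y → 0 < σ * x := by
    intro σ x y h h'
    have hy : 0 < y ^ 2 := by
      have := right_ne_zero_of_mul h.ne'
      positivity
    have : 0 < σ * x * y ^ 2 := by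
      have := mul_pos h h'
      linarith
    exact pos_of_mul_pos_left this hy.le
  obtain ⟨σ, g1, g2, g3, g4⟩ := h
  exact ⟨σ, key _ _ _ g1 h1, key _ _ _ g2 h2, key _ _ _ g3 h3, key _ _ _ g4 h4⟩

/-! ### Clusters over a Horton set, with dyadic targets. -/

/-- An enumeration of `ℕ` in which the dyadic neighbours `c ± 2 ^ v` of `c` come early. -/
def dyadicTarget (c g : ℕ) : ℕ :=
  if g % 3 = 0 then c + 2 ^ (g / 3) else if g % 3 = 1 then c - 2 ^ (g / 3) else g / 3

theorem exists_dyadic_targets {k : ℕ} (hk : 3 ≤ k) : ∃ tgt : Fin k → ℕ → Fin k,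
    (∀ c g, tgt c g ≠ c) ∧ ∀ (c b : Fin k) g, b ≠ c → dyadicTarget c g = b.1 → tgt c g = b := by
  have hother : ∀ c : Fin k, ∃ b, b ≠ c := fun c => by
    by_cases h : c.1 = 0
    · exact ⟨⟨1, by omega⟩, fun e => by have := congrArg Fin.val e; simp at this; omega⟩
    · exact ⟨⟨0, by omega⟩, fun e => by have := congrArg Fin.val e; simp at this; omega⟩
  choose other hother using hother
  refine ⟨fun c g => if h : dyadicTarget c g < k ∧ dyadicTarget c g ≠ c then
    ⟨dyadicTarget c g, h.1⟩ else other c, ?_, ?_⟩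
  · intro c g
    beta_reduce
    split_ifs with h
    · exact fun e => h.2 (congrArg Fin.val e)
    · exact hother c
  · intro c b g hbc hb
    have h : dyadicTarget c g < k ∧ dyadicTarget c g ≠ c := by
      rw [hb]
      exact ⟨b.2, fun e => hbc (Fin.ext e)⟩
    simp only [dif_pos h]
    exact Fin.ext hb

theorem exists_horton_blowup {k : ℕ} (hk : 3 ≤ k) (m : ℕ) : ∃ P : Fin k → Fin m → Plane,
    (∀ x y z : Fin k × Fin m, x ≠ y → x ≠ z → y ≠ z →
      orient (P x.1 x.2) (P y.1 y.2) (P z.1 z.2) ≠ 0) ∧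
    ∀ (o p q : Fin k) (i j l : Fin m) (t r o' p' q' : ℕ), IsDyadicSplit t r o' p' q' →
      o.1 = r + 2 ^ t * o' → p.1 = r + 2 ^ t * p' → q.1 = r + 2 ^ t * q' →
      (∀ d n, ¬ OrientInside (P o i) (P p j) (P q l) (P d n)) →
      ∃ s u, q' = p' + 2 ^ (s + 1) ∧
        (p' = 1 + 2 ^ (s + 1) * u ∨ p' = 2 ^ (s + 1) - 2 + 2 ^ (s + 1) * u) ∧
        i.1 < 6 * k ∧ j.1 < 6 * (t + s + 1) + 4 ∧ l.1 < 6 * (t + s + 1) + 4 := by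
  obtain ⟨η, hη⟩ := exists_isHortonParam k
  obtain ⟨tgt, htgt, htgt'⟩ := exists_dyadic_targets hk
  have hval : ∀ {a b : Fin k}, a ≠ b → a.1 ≠ b.1 := fun h e => h (Fin.ext e)
  obtain ⟨P, p1, p2, p3, p4⟩ := exists_cluster_blowup m (H := fun a : Fin k => hortonPoint η a)
    (fun a b c hab hac hbc => hη.orient_ne_zero (hval hab) (hval hac) (hval hbc) a.2 b.2 c.2)
    (fun a b h => by
      have := congrArg (fun v : Plane => v 0) h
      simp only [hortonPoint, Matrix.cons_val_zero] at this
      exact Fin.ext (by exact_mod_cast this)) tgt htgt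
  refine ⟨P, ?_, ?_⟩
  · rintro ⟨a, i⟩ ⟨b, j⟩ ⟨c, l⟩ hxy hxz hyz
    simp only [ne_eq, Prod.mk.injEq, not_and] at hxy hxz hyz ⊢
    by_cases hab : a = b
    · subst hab
      by_cases hac : a = c
      · subst hac
        exact p3 a i j l (hxy rfl) (hxz rfl) (hyz rfl)
      · exact p2 a i j c l (Ne.symm hac) (hxy rfl)
    · by_cases hac : a = c
      · subst hac
        have := p2 a l i b j (Ne.symm hab) (fun e => hxz rfl e.symm)
        rwa [← orient_rotate] at this
      · by_cases hbc : b = c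
        · subst hbc
          have := p2 b j l a i hab (hyz rfl)
          rwa [orient_rotate] at this
        · exact left_ne_zero_of_mul (p1 a b c i j l hab hac hbc).ne'
  · intro o p q i j l t r o' p' q' hs ho hp hq hempty
    have hop : o ≠ p := by
      rintro rfl
      have := Nat.eq_of_mul_eq_mul_left (by positivity) (Nat.add_left_cancel (ho.symm.trans hp))
      exact hs.parity_ne (by rw [this])
    have hoq : o ≠ q := by
      rintro rfl
      have := Nat.eq_of_mul_eq_mul_left (by positivity) (Nat.add_left_cancel (ho.symm.trans hq))
      exact hs.parity_ne (by rw [this, hs.parity_eq])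
    have hpq : p ≠ q := by
      rintro rfl
      have := Nat.eq_of_mul_eq_mul_left (by positivity) (Nat.add_left_cancel (hp.symm.trans hq))
      exact hs.lt.ne this
    -- Orientations across distinct clusters agree with those of the centers, so a center inside the
    -- Horton triangle would put its cluster inside the given one.
    obtain ⟨s, u, e1, e2⟩ := hη.dyadic_of_empty hs (ho ▸ o.2) (hq ▸ q.2) (by
      intro d hd hin
      rw [← ho, ← hp, ← hq] at hin
      have hne : ∀ x : Fin k, hortonPoint η d ≠ hortonPoint η x → (⟨d, hd⟩ : Fin k) ≠ x := by
        rintro x h rfl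
        exact h rfl
      obtain ⟨n1, n2, n3⟩ := hin.ne
      exact hempty ⟨d, hd⟩ i (hin.of_mul_pos (p1 _ _ _ _ _ _ hop hoq hpq)
        (p1 o p ⟨d, hd⟩ _ _ _ hop (hne o n1).symm (hne p n2).symm)
        (p1 p q ⟨d, hd⟩ _ _ _ hpq (hne p n2).symm (hne q n3).symm)
        (p1 q o ⟨d, hd⟩ _ _ _ hoq.symm (hne q n3).symm (hne o n1).symm)))
    have hqp : q.1 = p.1 + 2 ^ (t + s + 1) := by
      rw [hq, hp, e1, show t + s + 1 = t + (s + 1) by ring, pow_add]; ring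
    refine ⟨s, u, e1, e2, ?_, ?_, ?_⟩
    · by_contra! hge
      -- Slot `3 * p + 2` aims at `p` itself and yields the threshold `6 * p + 6 ≤ 6 * k`. The slots
      -- `3 * v` and `3 * v + 1`, with `v = t + s + 1`, yield `6 * v + 2` and `6 * v + 4`.
      have ht : tgt o (3 * p.1 + 2) = p := htgt' o p (3 * p.1 + 2) hop.symm (by
        rw [dyadicTarget, if_neg (by omega), if_neg (by omega)]; omega)
      have hpk := p.2
      obtain ⟨n, hn⟩ := p4 o (3 * p.1 + 2) i q hoq.symm (by rw [ht]; exact hpq.symm) (by omega) j l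
      rw [ht] at hn
      exact hempty _ _ hn
    · by_contra! hge
      have ht : tgt p (3 * (t + s + 1)) = q := htgt' p q (3 * (t + s + 1)) hpq.symm (by
        rw [dyadicTarget, if_pos (by omega), hqp, Nat.mul_div_cancel_left _ (by norm_num)])
      obtain ⟨n, hn⟩ := p4 p (3 * (t + s + 1)) j o hop (by rw [ht]; exact hoq) (by omega) l i
      rw [ht] at hn
      exact hempty _ _ hn.rotate.rotate
    · by_contra! hge
      have ht : tgt q (3 * (t + s + 1) + 1) = p := htgt' q p (3 * (t + s + 1) + 1) hpq (by
        rw [dyadicTarget, if_neg (by omega), if_pos (by omega),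
          show (3 * (t + s + 1) + 1) / 3 = t + s + 1 by omega, hqp]
        omega)
      obtain ⟨n, hn⟩ := p4 q (3 * (t + s + 1) + 1) l o hoq (by rw [ht]; exact hop) (by omega) j i
      rw [ht] at hn
      exact hempty _ _ hn.swap.rotate

theorem exists_coloredPointSet {k m : ℕ} (hk : 3 ≤ k) {Q : Fin k × Fin m → Plane}
    (hQ : ∀ x y z, x ≠ y → x ≠ z → y ≠ z → orient (Q x) (Q y) (Q z) ≠ 0) :
    ∃ S : ColoredPointSet k m, (∀ p, p ∈ S.points ↔ ∃ x, Q x = p) ∧ ∀ x, S.color (Q x) = x.1 := by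
  classical
  have hinj : Function.Injective Q := by
    intro x y h
    by_contra hxy
    -- As `k ≥ 3`, a third color exists; if two points coincided, a point of that color would
    -- complete a degenerate triple.
    obtain ⟨c, hc⟩ := Finset.exists_mem_notMem_of_card_lt_card
      (s := {x.1, y.1}) (t := (Finset.univ : Finset (Fin k)))
      (lt_of_le_of_lt Finset.card_le_two (by rw [Finset.card_univ, Fintype.card_fin]; omega))
    simp only [Finset.mem_univ, Finset.mem_insert, Finset.mem_singleton, not_or, true_and] at hc
    refine hQ x y (c, x.2) hxy ?_ ?_ ?_
    · rintro h; exact hc.1 (congrArg Prod.fst h).symm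
    · rintro h; exact hc.2 (congrArg Prod.fst h).symm
    · rw [h]; unfold orient; ring
  have hcol : ∀ x, Function.extend Q Prod.fst (fun _ => (⟨0, by omega⟩ : Fin k)) (Q x) = x.1 :=
    fun x => hinj.extend_apply _ _ x
  refine ⟨⟨Finset.univ.image Q, Function.extend Q Prod.fst (fun _ => ⟨0, by omega⟩), ?_, ?_⟩,
    by simp, hcol⟩
  · intro p hp q hq r hr hpq hpr hqr hc
    simp only [Finset.coe_image, Finset.coe_univ, Set.image_univ, Set.mem_range] at hp hq hr
    obtain ⟨x, rfl⟩ := hp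
    obtain ⟨y, rfl⟩ := hq
    obtain ⟨z, rfl⟩ := hr
    exact hQ x y z (fun h => hpq (congrArg Q h)) (fun h => hpr (congrArg Q h))
      (fun h => hqr (congrArg Q h)) (orient_eq_zero_of_collinear hc)
  · intro c
    have : (Finset.univ.image Q).filter
        (fun p => Function.extend Q Prod.fst (fun _ => (⟨0, by omega⟩ : Fin k)) p = c) =
        Finset.univ.image (fun i : Fin m => Q (c, i)) := by
      ext p
      simp only [Finset.mem_filter, Finset.mem_image, Finset.mem_univ, true_and]
      constructor
      · rintro ⟨⟨x, rfl⟩, h⟩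
        rw [hcol] at h
        exact ⟨x.2, by rw [← h]⟩
      · rintro ⟨i, rfl⟩
        exact ⟨⟨_, rfl⟩, hcol _⟩
    rw [this, Finset.card_image_of_injective, Finset.card_univ, Fintype.card_fin]
    intro i j h
    exact (Prod.ext_iff.1 (hinj h)).2

/-! ### Counting the empty rainbow triangles of the construction. -/

/-- The value `1256` is the sum of the full series; the closed form of the partial sums gives the
bound. -/
theorem sum_cube_div_two_pow_le (n : ℕ) :
    ∑ v ∈ Finset.range n, (v : ℝ) * (6 * v + 4) ^ 2 / 2 ^ v ≤ 1256 := by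
  have h : ∑ v ∈ Finset.range n, (v : ℝ) * (6 * v + 4) ^ 2 / 2 ^ v =
      1256 - (72 * (n : ℝ) ^ 3 + 312 * n ^ 2 + 872 * n + 1256) / 2 ^ n := by
    induction n with
    | zero => norm_num
    | succ n ih =>
      rw [Finset.sum_range_succ, ih]
      push_cast
      field_simp
      ring
  rw [h]
  have : 0 ≤ (72 * (n : ℝ) ^ 3 + 312 * n ^ 2 + 872 * n + 1256) / 2 ^ n := by positivity
  linarith

-- For fixed `t < v` there are at most `8 k² / 2 ^ v` choices of the three clusters, and `M (6 v +
-- 4)²` choices inside them. Summing over `t` contributes a factor `v`, and `10048 = 8 * 1256`.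
open Classical in
theorem ncard_le_of_dyadic_parametrization {k M : ℕ} (pt : ℕ → ℕ → Plane)
    {𝒯 : Set (Finset Plane)} (h : ∀ T ∈ 𝒯, ∃ t v r e u w i j l, t < v ∧ 2 ^ v ≤ k ∧ r < 2 ^ t ∧
      e < 2 ∧ u ≤ k / 2 ^ v ∧ w ≤ k / 2 ^ t ∧ i < M ∧ j < 6 * v + 4 ∧ l < 6 * v + 4 ∧
      T = {pt (r + 2 ^ t * w) i,
        pt (r + 2 ^ t * (if e = 0 then 1 else 2 ^ (v - t) - 2) + 2 ^ v * u) j,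
        pt (r + 2 ^ t * (if e = 0 then 1 else 2 ^ (v - t) - 2) + 2 ^ v * u + 2 ^ v) l}) :
    (𝒯.ncard : ℝ) ≤ 10048 * k ^ 2 * M := by
  let V := (Finset.range k).filter (fun v => 2 ^ v ≤ k)
  let E : ℕ → ℕ → Finset (ℕ × ℕ × ℕ × ℕ × ℕ × ℕ × ℕ) := fun v t =>
    Finset.range (2 ^ t) ×ˢ Finset.range 2 ×ˢ Finset.range (k / 2 ^ v + 1) ×ˢ
      Finset.range (k / 2 ^ t + 1) ×ˢ Finset.range M ×ˢ Finset.range (6 * v + 4) ×ˢ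
      Finset.range (6 * v + 4)
  let F : ℕ → ℕ → ℕ × ℕ × ℕ × ℕ × ℕ × ℕ × ℕ → Finset Plane := fun v t z =>
    {pt (z.1 + 2 ^ t * z.2.2.2.1) z.2.2.2.2.1,
      pt (z.1 + 2 ^ t * (if z.2.1 = 0 then 1 else 2 ^ (v - t) - 2) + 2 ^ v * z.2.2.1)
        z.2.2.2.2.2.1,
      pt (z.1 + 2 ^ t * (if z.2.1 = 0 then 1 else 2 ^ (v - t) - 2) + 2 ^ v * z.2.2.1 + 2 ^ v)
        z.2.2.2.2.2.2}
  have hsub : 𝒯 ⊆ (V.biUnion fun v => (Finset.range v).biUnion fun t => (E v t).image (F v t) :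
      Finset (Finset Plane)) := by
    intro T hT
    obtain ⟨t, v, r, e, u, w, i, j, l, h1, h2, h3, h4, h5, h6, h7, h8, h9, rfl⟩ := h T hT
    simp only [Finset.coe_biUnion, Set.mem_iUnion, Finset.coe_image, Set.mem_image, Finset.mem_coe]
    refine ⟨v, ?_, t, by simpa using h1, (r, e, u, w, i, j, l), ?_, rfl⟩
    · simp only [V, Finset.mem_filter, Finset.mem_range]
      exact ⟨Nat.lt_two_pow_self.trans_le h2, h2⟩
    · simp only [E, Finset.mem_product, Finset.mem_range]
      omega
  have hE : ∀ v ∈ V, ∀ t ∈ Finset.range v, (((E v t).image (F v t)).card : ℝ) ≤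
      8 * k ^ 2 * M * ((6 * v + 4) ^ 2 / 2 ^ v) := by
    intro v hv t ht
    simp only [V, Finset.mem_filter, Finset.mem_range] at hv ht
    have htk : 2 ^ t ≤ k := (Nat.pow_le_pow_right two_pos ht.le).trans hv.2
    -- The condition `2 ^ n ≤ k` absorbs the extra `1` at the cost of a factor `2`.
    have key : ∀ n, 2 ^ n ≤ k → 2 ^ n * (k / 2 ^ n + 1) ≤ 2 * k := by
      intro n hn
      have := Nat.mul_div_le k (2 ^ n)
      rw [mul_add, mul_one]
      omega
    have hnat : ((E v t).image (F v t)).card * 2 ^ v ≤ 8 * k ^ 2 * M * (6 * v + 4) ^ 2 := by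
      calc ((E v t).image (F v t)).card * 2 ^ v ≤ (E v t).card * 2 ^ v :=
            Nat.mul_le_mul_right _ Finset.card_image_le
        _ = 2 * (2 ^ v * (k / 2 ^ v + 1)) * (2 ^ t * (k / 2 ^ t + 1)) * M * (6 * v + 4) ^ 2 := by
            simp only [E, Finset.card_product, Finset.card_range]; ring
        _ ≤ 2 * (2 * k) * (2 * k) * M * (6 * v + 4) ^ 2 := by
            refine Nat.mul_le_mul_right _ (Nat.mul_le_mul_right _ (Nat.mul_le_mul
              (Nat.mul_le_mul_left _ (key v hv.2)) (key t htk)))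
        _ = _ := by ring
    rw [mul_div_assoc', le_div_iff₀ (by positivity)]
    exact_mod_cast hnat
  calc (𝒯.ncard : ℝ)
      ≤ ((V.biUnion fun v => (Finset.range v).biUnion fun t => (E v t).image (F v t)).card : ℝ) := by
        rw [← Set.ncard_coe_finset]
        exact_mod_cast Set.ncard_le_ncard hsub (Finset.finite_toSet _)
    _ ≤ ∑ v ∈ V, ∑ t ∈ Finset.range v, (((E v t).image (F v t)).card : ℝ) := by
        exact_mod_cast Finset.card_biUnion_le.trans
          (Finset.sum_le_sum fun v _ => Finset.card_biUnion_le)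
    _ ≤ ∑ v ∈ V, ∑ t ∈ Finset.range v, 8 * (k : ℝ) ^ 2 * M * ((6 * v + 4) ^ 2 / 2 ^ v) :=
        Finset.sum_le_sum fun v hv => Finset.sum_le_sum fun t ht => hE v hv t ht
    _ = 8 * (k : ℝ) ^ 2 * M * ∑ v ∈ V, (v : ℝ) * (6 * v + 4) ^ 2 / 2 ^ v := by
        rw [Finset.mul_sum]
        refine Finset.sum_congr rfl fun v _ => ?_
        rw [Finset.sum_const, Finset.card_range, nsmul_eq_mul]
        ring
    _ ≤ 8 * (k : ℝ) ^ 2 * M * 1256 := by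
        gcongr
        refine le_trans (Finset.sum_le_sum_of_subset_of_nonneg (Finset.filter_subset _ _) ?_)
          (sum_cube_div_two_pow_le k)
        intros
        positivity
    _ = _ := by ring

theorem exists_numEmptyRainbowTriangles_le {k : ℕ} (hk : 3 ≤ k) (m : ℕ) :
    ∃ S : ColoredPointSet k m,
      (S.numEmptyRainbowTriangles : ℝ) ≤ 10048 * k ^ 2 * (min m (6 * k) : ℕ) := by
  classical
  obtain ⟨P, hP, hempty⟩ := exists_horton_blowup hk m
  obtain ⟨S, hpts, hcol⟩ := exists_coloredPointSet hk (Q := fun x => P x.1 x.2) hP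
  refine ⟨S, ncard_le_of_dyadic_parametrization
    (fun n i => if h : n < k ∧ i < m then P ⟨n, h.1⟩ ⟨i, h.2⟩ else 0) ?_⟩
  set pt : ℕ → ℕ → Plane := fun n i => if h : n < k ∧ i < m then P ⟨n, h.1⟩ ⟨i, h.2⟩ else 0
    with hpt
  have hptP : ∀ (c : Fin k) (i : Fin m), pt c i = P c i := fun c i => by
    simp only [hpt]; rw [dif_pos ⟨c.2, i.2⟩]
  rintro T ⟨⟨hTsub, hTcard⟩, hTempty, hTrainbow⟩
  obtain ⟨x, y, z, hxy, hxz, hyz, rfl⟩ := Finset.card_eq_three.1 hTcard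
  obtain ⟨⟨a, ia⟩, rfl⟩ := (hpts x).1 (hTsub (by simp))
  obtain ⟨⟨b, ib⟩, rfl⟩ := (hpts y).1 (hTsub (by simp))
  obtain ⟨⟨c, ic⟩, rfl⟩ := (hpts z).1 (hTsub (by simp))
  have hne : ∀ x y : Fin k × Fin m, P x.1 x.2 ∈ ({P a ia, P b ib, P c ic} : Finset Plane) →
      P y.1 y.2 ∈ ({P a ia, P b ib, P c ic} : Finset Plane) → P x.1 x.2 ≠ P y.1 y.2 →
      x.1.1 ≠ y.1.1 := by
    intro x y hx hy hxy h
    refine hxy (hTrainbow hx hy ?_)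
    rw [hcol x, hcol y]
    exact Fin.ext h
  have hab : a.1 ≠ b.1 := hne (a, ia) (b, ib) (by simp) (by simp) hxy
  have hac : a.1 ≠ c.1 := hne (a, ia) (c, ic) (by simp) (by simp) hxz
  have hbc : b.1 ≠ c.1 := hne (b, ib) (c, ic) (by simp) (by simp) hyz
  obtain ⟨t, r, o', p', q', hs, he⟩ := exists_isDyadicSplit hab hac hbc
  let ix : ℕ → Fin m := fun n => if n = a.1 then ia else if n = b.1 then ib else ic
  have hlt : ∀ n ∈ ({a.1, b.1, c.1} : Finset ℕ), n < k := by
    intro n hn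
    simp only [Finset.mem_insert, Finset.mem_singleton] at hn
    rcases hn with rfl | rfl | rfl <;> exact Fin.isLt _
  have ho : r + 2 ^ t * o' < k := hlt _ (by rw [he]; simp)
  have hp : r + 2 ^ t * p' < k := hlt _ (by rw [he]; simp)
  have hq : r + 2 ^ t * q' < k := hlt _ (by rw [he]; simp)
  have hT : ({P a ia, P b ib, P c ic} : Finset Plane) = {pt (r + 2 ^ t * o') (ix (r + 2 ^ t * o')),
      pt (r + 2 ^ t * p') (ix (r + 2 ^ t * p')), pt (r + 2 ^ t * q') (ix (r + 2 ^ t * q'))} := by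
    have := congrArg (Finset.image (fun n => pt n (ix n))) he
    simp only [Finset.image_insert, Finset.image_singleton] at this
    rw [← this]
    simp only [ix, if_true, if_neg hab.symm, if_neg hac.symm, if_neg hbc.symm, hptP]
  obtain ⟨s, u, e1, e2, hi, hj, hl⟩ := hempty ⟨_, ho⟩ ⟨_, hp⟩ ⟨_, hq⟩ (ix (r + 2 ^ t * o'))
    (ix (r + 2 ^ t * p')) (ix (r + 2 ^ t * q')) t r o' p' q' hs rfl rfl rfl (by
      intro d n hin
      refine hTempty (P d n) ((hpts _).2 ⟨(d, n), rfl⟩) ?_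
      have hmem := hin.mem_interior
      rw [hT, hptP ⟨_, ho⟩, hptP ⟨_, hp⟩, hptP ⟨_, hq⟩]
      simpa using hmem)
  have hpow : 2 ^ t * q' = 2 ^ t * p' + 2 ^ (t + s + 1) := by
    rw [e1, show t + s + 1 = t + (s + 1) by ring, pow_add]; ring
  have hw : o' ≤ k / 2 ^ t := by
    rw [Nat.le_div_iff_mul_le (by positivity), mul_comm]; omega
  have hu : 2 ^ (t + s + 1) * u ≤ 2 ^ t * p' := by
    rw [show t + s + 1 = t + (s + 1) by ring, pow_add, mul_assoc]
    apply Nat.mul_le_mul_left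
    omega
  have hbase : 2 ^ t * p' =
      2 ^ t * (if (if p' = 1 + 2 ^ (s + 1) * u then 0 else 1) = 0 then 1
        else 2 ^ (t + s + 1 - t) - 2) + 2 ^ (t + s + 1) * u := by
    rw [show t + s + 1 - t = s + 1 by omega, show t + s + 1 = t + (s + 1) by ring,
      pow_add 2 t (s + 1), mul_assoc (2 ^ t), ← mul_add]
    congr 1
    by_cases h1 : p' = 1 + 2 ^ (s + 1) * u
    · rw [if_pos h1, if_pos rfl]
      exact h1
    · rw [if_neg h1, if_neg one_ne_zero]
      exact e2.resolve_left h1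
  refine ⟨t, t + s + 1, r, if p' = 1 + 2 ^ (s + 1) * u then 0 else 1, u, o',
    ix (r + 2 ^ t * o'), ix (r + 2 ^ t * p'), ix (r + 2 ^ t * q'), by omega, by omega,
    hs.residue_lt, by split_ifs <;> norm_num, ?_, hw, lt_min (Fin.isLt _) hi, hj, hl, ?_⟩
  · rw [Nat.le_div_iff_mul_le (by positivity), mul_comm]; omega
  · rw [hT, add_assoc r (2 ^ t * _) (2 ^ (t + s + 1) * u), ← hbase, add_assoc r, ← hpow]

/-! ### Combining the two bounds. -/

theorem minEmptyRainbowTriangles_bounds {k : ℕ} (hk : 3 ≤ k) (m : ℕ) :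
    (1 / 1000 : ℝ) * (k ^ 2 * (min m k : ℕ)) ≤ minEmptyRainbowTriangles k m ∧
      (minEmptyRainbowTriangles k m : ℝ) ≤ 60288 * (k ^ 2 * (min m k : ℕ)) := by
  obtain ⟨S, hS⟩ := exists_numEmptyRainbowTriangles_le hk m
  constructor
  -- The infimum of an empty set of naturals would be `0`; the constructed `S` ensures that the
  -- minimum is attained.
  · obtain ⟨S', hS'⟩ := Nat.sInf_mem
      (Set.range_nonempty_iff_nonempty.2 ⟨S⟩ :
        (Set.range (fun S : ColoredPointSet k m => S.numEmptyRainbowTriangles)).Nonempty)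
    have h := S'.sq_mul_min_le_numEmptyRainbowTriangles hk
    rw [minEmptyRainbowTriangles, ← hS']
    have h' : ((k : ℝ) ^ 2 * (min m k : ℕ)) ≤ 1000 * (S'.numEmptyRainbowTriangles : ℝ) := by
      exact_mod_cast h
    simp only
    linarith
  · have h1 : minEmptyRainbowTriangles k m ≤ S.numEmptyRainbowTriangles := Nat.sInf_le ⟨S, rfl⟩
    have h2 : ((min m (6 * k) : ℕ) : ℝ) ≤ 6 * (min m k : ℕ) := by
      exact_mod_cast (by omega : min m (6 * k) ≤ 6 * min m k)
    calc (minEmptyRainbowTriangles k m : ℝ) ≤ S.numEmptyRainbowTriangles := by exact_mod_cast h1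
      _ ≤ 10048 * k ^ 2 * (min m (6 * k) : ℕ) := hS
      _ ≤ 10048 * k ^ 2 * (6 * (min m k : ℕ)) := by gcongr
      _ = _ := by ring

theorem theorem1 :
    (∃ c C : ℝ, 0 < c ∧ 0 < C ∧ ∀ k m : ℕ, 3 ≤ k → m < k →
      c * ((k : ℝ) ^ 2 * (m : ℝ)) ≤ (minEmptyRainbowTriangles k m : ℝ) ∧
        (minEmptyRainbowTriangles k m : ℝ) ≤ C * ((k : ℝ) ^ 2 * (m : ℝ))) ∧
    (∃ c C : ℝ, 0 < c ∧ 0 < C ∧ ∀ k m : ℕ, 3 ≤ k → k ≤ m →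
      c * (k : ℝ) ^ 3 ≤ (minEmptyRainbowTriangles k m : ℝ) ∧
        (minEmptyRainbowTriangles k m : ℝ) ≤ C * (k : ℝ) ^ 3) := by
  refine ⟨⟨1 / 1000, 60288, by norm_num, by norm_num, fun k m hk hm => ?_⟩,
    ⟨1 / 1000, 60288, by norm_num, by norm_num, fun k m hk hm => ?_⟩⟩
  · have := minEmptyRainbowTriangles_bounds hk m
    rwa [min_eq_left hm.le] at this
  · have := minEmptyRainbowTriangles_bounds hk m
    rwa [min_eq_right hm, ← pow_succ] at this
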